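/- Let $\phi(t)=\sum_{k\in\mathbb Z}\frac{e^{-4\pi^2ik^2t}-1}{-4\pi^2k^2}$ (the term $k=0$ is read as its limit $it$) and $t_{p,q}=\frac{p/q}{2\pi}$. Let $Z_1(h)=\sum_{k\ge 1,\ k\text{ odd}}\frac{e^{ik^2/(16h)}}{k^2}$ and $h^{3/2}=(\sqrt h)^3$, where $\sqrt{h}=-i\sqrt{|h|}$ for $h<0$. Let $p\in\mathbb Z$, $q\in\mathbb N$ be coprime with $q\equiv 2\pmod 4$, and let $\tilde p/\tilde q$, $\tilde q>0$, be the irreducible fraction equal to $2p/q$. Call an integer $c$ admissible for $(p,q)$ if there are integers $a,b,d$ with $ad-bc=1$, $a\equiv d\not\equiv b\equiv c\pmod 2$, $a=c+\tilde q$ and $b=d-\tilde p$; then the theta-modular map $\gamma(x)=\frac{ax+b}{cx+d}$ satisfies $\gamma(\tilde p/\tilde q)=1$. For admissible $c_+,c_-$ with $\tilde q\le c_+\le 3\tilde q$ and $-3\tilde q\le c_-\le-\tilde q$, write $c_\pm=c_+$ if $h\ge0$ and $c_\pm=c_-$ if $h<0$, and set $$b(h)=\frac{\tilde q^2h}{1+4\pi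 c_\pm\tilde q h},\qquad \beta(h)=b(h/\tilde q^2).$$ Then there is an absolute constant $C>0$ such that for all $p,q$ as above there are numbers $e_{p,q}(c)$, depending only on $p,q$ and $c$, with the following properties. For every admissible $c$, $e_{p,q}(c)^8=1$. For all admissible $c,c'$, $e_{p,q}(c')=e_{p,q}(c)\,e^{i\pi(c-c')/(4\tilde q)}$ (so $e_{p,q}(c_-)=-e_{p,q}(c_+)$ when $c_\pm=c_0\pm2\tilde q$). For all $c_+,c_-$ as above, $$\phi(t_{p,q}+h)-\phi(t_{p,q})=e_{p,q}(c_\pm)\left(-16\,\frac{1-i}{\sqrt{2\pi}}\,Z_1(b(h))\,\tilde q^{3/2}h^{3/2}+R(h)\right),\qquad |R(h)|\le C\,\tilde q^{7/2}|h|^{5/2},$$ for all real $h$ with $|h|<\frac{1}{4\pi|c_\pm|/\tilde q}\,\frac1{\tilde q^2}$; and, rescaling the variable, $$\phi\Big(t_{p,q}+\frac{h}{\tilde q^2}\Big)-\phi(t_{p,q})=\frac{e_{p,q}(c_\pm)}{\tilde q^{3/2}}\left(-16\,\frac{1-i}{\sqrt{2\pi}}\,Z_1(\beta(h))\,h^{3/2}+\rho(h)\right),\qquad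 |\rho(h)|\le C\,|h|^{5/2},$$ for all real $h$ with $|h|<\frac{1}{4\pi|c_\pm|/\tilde q}$. (At $h=0$ both sides vanish, the product $Z_1(0)\cdot 0$ being read as $0$.) -/

import Mathlib

namespace RiemannFunction

open Complex

/-- The `k`-th term of Riemann's function. For `k = 0` the quotient
`(exp(-4π²ik²t) - 1) / (-4π²k²)` is read as its limit `i t` as `k → 0`. -/
noncomputable def phiTerm (t : ℝ) (k : ℤ) : ℂ :=
  if k = 0 then I * (t : ℂ)
  else (exp (-4 * (Real.pi : ℂ) ^ 2 * I * (k : ℂ) ^ 2 * (t : ℂ)) - 1)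
    / (-4 * (Real.pi : ℂ) ^ 2 * (k : ℂ) ^ 2)

/-- Riemann's non-differentiable function
`φ(t) = ∑_{k ∈ ℤ} (exp(-4π²ik²t) - 1) / (-4π²k²)` (an absolutely convergent series). -/
noncomputable def phi (t : ℝ) : ℂ := ∑' k : ℤ, phiTerm t k

/-- The rational time `t_{p,q} = (p/q) / (2π)`. -/
noncomputable def tpq (p : ℤ) (q : ℕ) : ℝ := ((p : ℝ) / (q : ℝ)) / (2 * Real.pi)

/-- The numerator `p̃` of the irreducible fraction `p̃/q̃ = 2p/q`. -/
def pTilde (p : ℤ) (q : ℕ) : ℤ := (2 * (p : ℚ) / (q : ℚ)).num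

/-- The (positive) denominator `q̃` of the irreducible fraction `p̃/q̃ = 2p/q`. -/
def qTilde (p : ℤ) (q : ℕ) : ℕ := (2 * (p : ℚ) / (q : ℚ)).den

/-- `Z₁(h) = ∑_{k ≥ 1 odd} exp(ik²/(16h)) / k²`, with `k = 2j + 1`. -/
noncomputable def Z1 (h : ℝ) : ℂ :=
  ∑' j : ℕ, exp (I * (2 * (j : ℂ) + 1) ^ 2 / (16 * (h : ℂ))) / (2 * (j : ℂ) + 1) ^ 2

/-- The square root of a real number with the branch `√(-1) = -i`. -/
noncomputable def sqrtB (h : ℝ) : ℂ :=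
  if 0 ≤ h then (Real.sqrt h : ℂ) else -I * (Real.sqrt (-h) : ℂ)

/-- `c` is the lower left coefficient of a map `γ(x) = (ax + b)/(cx + d)` of the theta-modular
group (integer coefficients, `ad - bc = 1`, `a ≡ d ≢ b ≡ c` mod 2) with `a = c + Q` and
`b = d - P`; such a `γ` satisfies `γ(P/Q) = 1`. -/
def IsThetaCoeff (P Q c : ℤ) : Prop :=
  ∃ a b d : ℤ, a * d - b * c = 1 ∧
    (a ≡ d [ZMOD 2] ∧ b ≡ c [ZMOD 2] ∧ ¬ a ≡ b [ZMOD 2]) ∧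
    a = c + Q ∧ b = d - P

/-- `c_± = c_+` for `h ≥ 0` and `c_± = c_-` for `h < 0`. -/
noncomputable def cpm (cp cm : ℤ) (h : ℝ) : ℤ := if 0 ≤ h then cp else cm

/-- `b(h) = Q² h / (1 + 4π c_± Q h)`. -/
noncomputable def bFun (Q : ℕ) (cp cm : ℤ) (h : ℝ) : ℝ :=
  (Q : ℝ) ^ 2 * h / (1 + 4 * Real.pi * (cpm cp cm h : ℝ) * (Q : ℝ) * h)

end RiemannFunction

/-! Write `P/Q` for the reduced fraction; both entries are odd. With `w = ih` the increment of `phi`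
is the boundary value of a function `D` (`increment`), holomorphic on `Re w > 0`, continuous up to
the imaginary axis, with `D 0 = 0`. Its derivative is the theta series of `χ(k) exp(-4π²wk²)` with
`χ(k) = exp(-πi k²P/Q)` (`phi_add_sub_phi`, `hasDerivAt_increment`).

Since `χ(k + Q) = -χ(k)`, Poisson summation on residue classes mod `Q` leaves only odd frequencies
`n`, weighted by Gauss sums (`tsum_chi_exp`). If `Pc + Qd = 1`, completing the square makes the
weight a constant times `exp(πi c n²/(4Q))` (`oddGauss_eq`). The normalised constant is the
multiplier `e(c)`. It is an eighth root of unity because a quadratic Gauss sum of odd modulus `N`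
has eighth power `N⁴` (`quadGauss_zmod_pow_eight`).

So, up to normalisation, `D'` is a sum of `u_n w^(-1/2) exp(-An²/w)` with `|u_n| ≤ 1` and `A =
1/(16Q²)`. Two integrations by parts give a main term of order `w^(3/2)/A` and an error of order
`w^(5/2)/A²`, uniformly in `P, Q, c` (`norm_sub_tsum_ibpMain_le`). At `w = ih` the quadratic phase
merges with `exp(-An²/w)` into `exp(in²/(16 b(h)))`, so the main term is `Z1 (b(h))`
(`tsum_ibpMain_eq`). -/

namespace RiemannFunction

open Complex Filter Topology

/-! ### Quadratic Gauss sums over finite rings -/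

section GaussSum

variable {R : Type*} [CommRing R] [Fintype R]

/-- The quadratic Gauss sum of an additive character. -/
noncomputable def quadGauss (ψ : AddChar R ℂ) (a : R) : ℂ := ∑ x : R, ψ (a * x ^ 2)

/-- Substituting `x = u + y` turns `ax² - ay²` into `au² + 2auy`. The sum over `y` is then an
orthogonality relation, and since `2a` is a unit only `u = 0` survives. -/
theorem quadGauss_mul_neg [DecidableEq R] {ψ : AddChar R ℂ} (hψ : ψ.IsPrimitive) {a : R}
    (ha : IsUnit a) (h2 : IsUnit (2 : R)) :
    quadGauss ψ a * quadGauss ψ (-a) = Fintype.card R := by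
  have h0 : ∀ u : R, 2 * a * u = 0 ↔ u = 0 := fun u => by
    rw [(h2.mul ha).mul_right_eq_zero]
  calc quadGauss ψ a * quadGauss ψ (-a)
      = ∑ y : R, ∑ x : R, ψ (a * x ^ 2 + -a * y ^ 2) := by
        simp only [quadGauss, Finset.sum_mul_sum, AddChar.map_add_eq_mul]
        exact Finset.sum_comm
    _ = ∑ y : R, ∑ u : R, ψ (a * u ^ 2) * ψ (y * (2 * a * u)) := by
        refine Finset.sum_congr rfl fun y _ => ?_
        rw [← Equiv.sum_comp (Equiv.addRight y)]
        refine Finset.sum_congr rfl fun u _ => ?_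
        rw [← AddChar.map_add_eq_mul]
        congr 1
        simp only [Equiv.coe_addRight]
        ring
    _ = ∑ u : R, ψ (a * u ^ 2) * ∑ y : R, ψ (y * (2 * a * u)) := by
        rw [Finset.sum_comm]
        simp only [Finset.mul_sum]
    _ = Fintype.card R := by
        simp [AddChar.sum_mulShift _ hψ, h0]

/-- The fourth power is a sum over quaternions of `ψ` of a multiple of the norm form. Left
multiplication by `x + yi + zj + wk` scales the norm by `m` and permutes the quaternions over `R`
when `m` is a unit. -/
theorem quadGauss_mul_sum_four_squares (ψ : AddChar R ℂ) (a : R) {x y z w : R}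
    (hm : IsUnit (x ^ 2 + y ^ 2 + z ^ 2 + w ^ 2)) :
    quadGauss ψ (a * (x ^ 2 + y ^ 2 + z ^ 2 + w ^ 2)) ^ 4 = quadGauss ψ a ^ 4 := by
  set m := x ^ 2 + y ^ 2 + z ^ 2 + w ^ 2 with hmdef
  have key : ∀ b : R, quadGauss ψ b ^ 4 = ∑ v : R × R × R × R,
      ψ (b * (v.1 ^ 2 + v.2.1 ^ 2 + v.2.2.1 ^ 2 + v.2.2.2 ^ 2)) := fun b => by
    simp only [Fintype.sum_prod_type, mul_add, AddChar.map_add_eq_mul, ← Finset.mul_sum,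
      ← Finset.sum_mul, quadGauss]
    ring
  -- Left multiplication by the quaternion; its conjugate supplies the combinations that prove
  -- injectivity.
  let L : R × R × R × R → R × R × R × R := fun v =>
    (x * v.1 - y * v.2.1 - z * v.2.2.1 - w * v.2.2.2,
     x * v.2.1 + y * v.1 + z * v.2.2.2 - w * v.2.2.1,
     x * v.2.2.1 - y * v.2.2.2 + z * v.1 + w * v.2.1,
     x * v.2.2.2 + y * v.2.2.1 - z * v.2.1 + w * v.1)
  have hL : Function.Injective L := by
    rintro ⟨p, q, r, s⟩ ⟨p', q', r', s'⟩ h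
    simp only [L, Prod.mk.injEq] at h
    obtain ⟨h1, h2, h3, h4⟩ := h
    have e1 : m * p = m * p' := by
      rw [hmdef]; linear_combination x * h1 + y * h2 + z * h3 + w * h4
    have e2 : m * q = m * q' := by
      rw [hmdef]; linear_combination x * h2 - y * h1 + w * h3 - z * h4
    have e3 : m * r = m * r' := by
      rw [hmdef]; linear_combination x * h3 - z * h1 + y * h4 - w * h2
    have e4 : m * s = m * s' := by
      rw [hmdef]; linear_combination x * h4 - w * h1 + z * h2 - y * h3
    simp only [Prod.mk.injEq]
    exact ⟨hm.mul_left_cancel e1, hm.mul_left_cancel e2, hm.mul_left_cancel e3,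
      hm.mul_left_cancel e4⟩
  rw [key, key]
  symm
  rw [← Equiv.sum_comp (Equiv.ofBijective L (Finite.injective_iff_bijective.mp hL))]
  refine Finset.sum_congr rfl fun v _ => ?_
  congr 1
  simp only [Equiv.ofBijective_apply, L, hmdef]
  ring

end GaussSum

/-- Lagrange's theorem writes `-1` as a sum of four squares mod `N`, so the sums at `a` and `-a`
have equal fourth powers, while their product is `N`. No evaluation of the Gauss sum is needed. -/
theorem quadGauss_zmod_pow_eight {N : ℕ} [NeZero N] (hN : Odd N) {a : ZMod N} (ha : IsUnit a) :
    quadGauss (ZMod.stdAddChar (N := N)) a ^ 8 = (N : ℂ) ^ 4 := by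
  have h2 : IsUnit (2 : ZMod N) := by
    have := (ZMod.isUnit_iff_coprime 2 N).mpr (Nat.coprime_two_left.mpr hN)
    exact_mod_cast this
  have h1 := quadGauss_mul_neg (ZMod.isPrimitive_stdAddChar N) ha h2
  rw [ZMod.card] at h1
  obtain ⟨x, y, z, w, h⟩ := Nat.sum_four_squares (N - 1)
  have hm : ((x : ZMod N) ^ 2 + (y : ZMod N) ^ 2 + (z : ZMod N) ^ 2 + (w : ZMod N) ^ 2) = -1 := by
    have : ((x ^ 2 + y ^ 2 + z ^ 2 + w ^ 2 : ℕ) : ZMod N) = ((N - 1 : ℕ) : ZMod N) := by rw [h]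
    rw [Nat.cast_sub hN.pos] at this
    push_cast at this
    rw [this]
    simp
  have h3 := quadGauss_mul_sum_four_squares (ZMod.stdAddChar (N := N)) a
    (x := x) (y := y) (z := z) (w := w) (by rw [hm]; exact isUnit_one.neg)
  rw [hm, mul_neg_one] at h3
  rw [← h1, mul_pow, h3]
  ring

theorem sum_zmod_eq_sum_range {N : ℕ} [NeZero N] (f : ZMod N → ℂ) :
    ∑ x : ZMod N, f x = ∑ r ∈ Finset.range N, f (r : ZMod N) := by
  symm
  refine Finset.sum_nbij' (fun r => (r : ZMod N)) ZMod.val (by simp) ?_ ?_ (by simp) (by simp)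
  · intro x _
    simpa using ZMod.val_lt x
  · intro r hr
    exact ZMod.val_cast_of_lt (Finset.mem_range.mp hr)

theorem sum_range_shift_of_periodic {N : ℕ} {f : ℤ → ℂ} (hf : ∀ r, f (r + N) = f r) (j : ℤ) :
    ∑ r ∈ Finset.range N, f (r + j) = ∑ r ∈ Finset.range N, f r := by
  have step : ∀ j : ℤ, ∑ r ∈ Finset.range N, f (r + (j + 1)) = ∑ r ∈ Finset.range N, f (r + j) := by
    intro j
    have h := Finset.sum_range_succ' (fun r : ℕ => f (r + j)) N
    rw [Finset.sum_range_succ] at h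
    have h' : f ((N : ℤ) + j) = f (((0 : ℕ) : ℤ) + j) := by
      rw [add_comm, hf]; simp
    rw [h', add_left_inj] at h
    rw [h]
    refine Finset.sum_congr rfl fun r _ => ?_
    congr 1
    push_cast
    ring
  induction j using Int.induction_on with
  | zero => simp
  | succ i ih => rw [step, ih]
  | pred i ih => rw [← ih, ← step, sub_add_cancel]

/-! ### The Fourier coefficients of `k ↦ exp (-π i k² P / Q)` -/

/-- The summand of `oddGauss`. -/
noncomputable def oddGaussTerm (P : ℤ) (Q : ℕ) (n r : ℤ) : ℂ :=
  exp (-(I * Real.pi * (P * r ^ 2 - r * n) / Q))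

/-- The Gauss sum `∑_{r mod Q} exp (-π i (P r² - r n) / Q)`. -/
noncomputable def oddGauss (P : ℤ) (Q : ℕ) (n : ℤ) : ℂ :=
  ∑ r ∈ Finset.range Q, oddGaussTerm P Q n r

/-- The phase changes by a multiple of `πi` whose parity is that of `PQ - n`, up to even terms; this
is even because all three numbers are odd. -/
theorem oddGaussTerm_add {P : ℤ} {Q : ℕ} {n : ℤ} (hP : Odd P) (hQ : Odd Q) (hn : Odd n) (r : ℤ) :
    oddGaussTerm P Q n (r + Q) = oddGaussTerm P Q n r := by
  have hQ0 : (Q : ℂ) ≠ 0 := by exact_mod_cast hQ.pos.ne'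
  obtain ⟨m, hm⟩ : Even (P * Q - n) := (hP.mul ((Int.odd_coe_nat Q).mpr hQ)).sub_odd hn
  have hm' : (P : ℂ) * Q - n = m + m := by exact_mod_cast hm
  unfold oddGaussTerm
  rw [exp_eq_exp_iff_exists_int]
  refine ⟨-(P * r + m), ?_⟩
  push_cast
  field_simp
  linear_combination (-(Q : ℂ)) * hm'

theorem oddGaussTerm_add_right (P : ℤ) {Q : ℕ} (hQ : Q ≠ 0) (n k r : ℤ) :
    oddGaussTerm P Q (n + 2 * Q * k) r = oddGaussTerm P Q n r := by
  have hQ0 : (Q : ℂ) ≠ 0 := by exact_mod_cast hQ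
  unfold oddGaussTerm
  rw [exp_eq_exp_iff_exists_int]
  refine ⟨r * k, ?_⟩
  push_cast
  field_simp
  ring

theorem oddGaussTerm_shift (P : ℤ) (Q : ℕ) (n j r : ℤ) :
    oddGaussTerm P Q n (r + j) = exp (-(I * Real.pi * (P * j ^ 2 - j * n) / Q)) *
      oddGaussTerm P Q (n - 2 * P * j) r := by
  unfold oddGaussTerm
  rw [← exp_add]
  congr 1
  push_cast
  ring

theorem oddGauss_shift {P : ℤ} {Q : ℕ} {n : ℤ} (hP : Odd P) (hQ : Odd Q) (hn : Odd n) (j : ℤ) :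
    oddGauss P Q n = exp (-(I * Real.pi * (P * j ^ 2 - j * n) / Q)) *
      oddGauss P Q (n - 2 * P * j) := by
  have h := sum_range_shift_of_periodic (fun r => oddGaussTerm_add hP hQ hn r) j
  simp only [oddGaussTerm_shift, ← Finset.mul_sum] at h
  exact h.symm

/-- Completing the square in the Gauss sum. -/
theorem oddGauss_eq {P : ℤ} {Q : ℕ} {n c d : ℤ} (hP : Odd P) (hQ : Odd Q) (hn : Odd n)
    (hcd : P * c + Q * d = 1) :
    oddGauss P Q n = oddGauss P Q 1 * exp (-(I * Real.pi * c / (4 * Q))) *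
      exp (I * Real.pi * c * n ^ 2 / (4 * Q)) := by
  have hQ0 : (Q : ℂ) ≠ 0 := by exact_mod_cast hQ.pos.ne'
  have hcd' : (P : ℂ) * c + Q * d = 1 := by exact_mod_cast hcd
  obtain ⟨m, hm⟩ := hn
  have hn : Odd n := ⟨m, hm⟩
  -- With `n = 2m + 1`, the shift by `mc` reduces `n` to `1` modulo `2Q`, since `Pc ≡ 1` mod `Q`.
  have e1 : oddGauss P Q (n - 2 * P * (m * c)) = oddGauss P Q 1 := by
    have : n - 2 * P * (m * c) = 1 + 2 * Q * (m * d) := by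
      rw [hm]; linear_combination -2 * m * hcd
    rw [this]
    simp only [oddGauss, oddGaussTerm_add_right P hQ.pos.ne']
  rw [oddGauss_shift hP hQ hn (m * c), e1, mul_comm, mul_assoc (oddGauss P Q 1), ← exp_add]
  congr 1
  -- The two phases differ by `πi c d m²`. As `P, Q` are odd and `Pc + Qd = 1`, the numbers `c, d`
  -- are not both odd, so this is a multiple of `2πi`.
  obtain ⟨l, hl⟩ : Even (c * d * m ^ 2) := by
    have : Even (c * d) := by
      by_contra h
      rw [Int.not_even_iff_odd, Int.odd_mul] at h
      have h1 := (hP.mul h.1).add_odd (((Int.odd_coe_nat Q).mpr hQ).mul h.2)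
      rw [hcd] at h1
      exact absurd h1 (by decide)
    exact this.mul_right _
  have hm' : (n : ℂ) = 2 * m + 1 := by exact_mod_cast hm
  have hl' : (c : ℂ) * d * m ^ 2 = l + l := by exact_mod_cast hl
  rw [exp_eq_exp_iff_exists_int]
  refine ⟨l, ?_⟩
  push_cast
  rw [hm']
  field_simp
  linear_combination (4 * (Q : ℂ)) * hl' - 4 * (c : ℂ) * m ^ 2 * hcd'

/-- At `n = Q` the integer `Pr² - rQ` is even, so each term is the standard character of `ZMod Q` at
`-Pr²/2`, and the sum is a genuine quadratic Gauss sum. -/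
theorem oddGauss_pow_eight {P : ℤ} {Q : ℕ} (hP : Odd P) (hQ : Odd Q) (hPQ : IsCoprime P Q) :
    oddGauss P Q Q ^ 8 = (Q : ℂ) ^ 4 := by
  have : NeZero Q := ⟨hQ.pos.ne'⟩
  have hQ0 : (Q : ℂ) ≠ 0 := by exact_mod_cast hQ.pos.ne'
  have h2 : IsUnit (2 : ZMod Q) := by
    have := (ZMod.isUnit_iff_coprime 2 Q).mpr (Nat.coprime_two_left.mpr hQ)
    exact_mod_cast this
  have hPu : IsUnit (P : ZMod Q) := by
    obtain ⟨a, b, h⟩ := hPQ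
    have := congrArg (Int.cast : ℤ → ZMod Q) h
    push_cast at this
    simp only [ZMod.natCast_self, mul_zero, add_zero] at this
    exact IsUnit.of_mul_eq_one_right _ this
  obtain ⟨t, ht⟩ := h2.exists_left_inv
  have ha : IsUnit (-(P : ZMod Q) * t) := hPu.neg.mul (IsUnit.of_mul_eq_one _ ht)
  rw [← quadGauss_zmod_pow_eight hQ ha, quadGauss, sum_zmod_eq_sum_range, oddGauss]
  congr 1
  refine Finset.sum_congr rfl fun r _ => ?_
  obtain ⟨s, hs⟩ : Even ((r : ℤ) * (P * r - Q)) := by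
    have hQ' : Odd (Q : ℤ) := (Int.odd_coe_nat Q).mpr hQ
    rcases Int.even_or_odd (r : ℤ) with h | h
    · exact h.mul_right _
    · exact ((hP.mul h).sub_odd hQ').mul_left _
  have e : -(P : ZMod Q) * t * (r : ZMod Q) ^ 2 = ((-s : ℤ) : ZMod Q) := by
    have := congrArg (Int.cast : ℤ → ZMod Q) hs
    push_cast at this
    simp only [ZMod.natCast_self, sub_zero] at this
    push_cast
    linear_combination (-t) * this - (s : ZMod Q) * ht
  have hs' : (r : ℂ) * (P * r - Q) = s + s := by exact_mod_cast hs
  rw [e, ZMod.stdAddChar_coe, oddGaussTerm]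
  congr 1
  push_cast
  field_simp
  linear_combination (-1 : ℂ) * hs'

/-! ### The theta series at odd/odd rationals -/

theorem ofReal_mul_cpow {r : ℝ} (hr : 0 < r) {z : ℂ} (hz : z ≠ 0) (s : ℂ) :
    (r * z : ℂ) ^ s = (r : ℂ) ^ s * z ^ s := by
  have hr' : (r : ℂ) ≠ 0 := by exact_mod_cast hr.ne'
  rw [cpow_def_of_ne_zero (mul_ne_zero hr' hz), cpow_def_of_ne_zero hr', cpow_def_of_ne_zero hz,
    log_ofReal_mul hr hz, ← exp_add, ofReal_log hr.le]
  ring_nf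

theorem ofReal_cpow_half {r : ℝ} (hr : 0 ≤ r) : (r : ℂ) ^ (1 / 2 : ℂ) = (Real.sqrt r : ℂ) := by
  rw [Real.sqrt_eq_rpow, ofReal_cpow hr]
  norm_num

theorem summable_exp_neg_mul_int_sq {a : ℂ} (ha : 0 < a.re) :
    Summable fun k : ℤ => exp (-(a * (k : ℂ) ^ 2)) := by
  have h := (summable_jacobiTheta₂_term_iff 0 (I * a / Real.pi)).mpr (by
    have : (I * a / Real.pi).im = a.re / Real.pi := by
      rw [div_ofReal_im]; simp
    rw [this]
    positivity)
  refine h.congr fun k => ?_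
  have : (Real.pi : ℂ) ≠ 0 := by exact_mod_cast Real.pi_ne_zero
  rw [jacobiTheta₂_term]
  congr 1
  field_simp
  linear_combination (k ^ 2 * a) * I_sq

theorem re_inv_pos {w : ℂ} (hw : 0 < w.re) : 0 < (w⁻¹).re := by
  have h0 : w ≠ 0 := fun h => by simp [h] at hw
  rw [inv_re]
  exact div_pos hw (normSq_pos.mpr h0)

theorem summable_exp_neg_odd_sq_div {w : ℂ} (hw : 0 < w.re) {Q : ℕ} (hQ : Q ≠ 0) :
    Summable fun j : ℤ => exp (-((2 * (j : ℂ) + 1) ^ 2 / (16 * (Q : ℂ) ^ 2 * w))) := by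
  have hpos : 0 < ((16 * (Q : ℂ) ^ 2 * w)⁻¹).re := by
    apply re_inv_pos
    have : (16 * (Q : ℂ) ^ 2 * w) = ((16 * (Q : ℝ) ^ 2 : ℝ) : ℂ) * w := by push_cast; ring
    rw [this, re_ofReal_mul]
    positivity
  have h := (summable_exp_neg_mul_int_sq hpos).comp_injective
    (i := fun j : ℤ => 2 * j + 1) (fun a b h => by simpa using h)
  refine h.congr fun j => ?_
  simp only [Function.comp]
  congr 1
  push_cast
  ring

/-- Poisson summation for a Gaussian. The sign `(-1)^m` shifts the dual variable by one half, which
is why only odd numbers `2j + 1` appear. -/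
theorem tsum_exp_residue {w : ℂ} (hw : 0 < w.re) {Q : ℕ} (hQ : Q ≠ 0) (r : ℂ) :
    ∑' m : ℤ, exp (I * Real.pi * m) * exp (-(4 * Real.pi ^ 2 * w * (m * Q + r) ^ 2))
      = 1 / (Q * (4 * Real.pi * w) ^ (1 / 2 : ℂ)) * ∑' j : ℤ, exp (I * Real.pi * r * (2 * j + 1) / Q)
        * exp (-((2 * (j : ℂ) + 1) ^ 2 / (16 * (Q : ℂ) ^ 2 * w))) := by
  have hQ0 : (Q : ℂ) ≠ 0 := by exact_mod_cast hQ
  have hw0 : w ≠ 0 := fun h => by simp [h] at hw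
  have hpi : (Real.pi : ℂ) ≠ 0 := by exact_mod_cast Real.pi_ne_zero
  have hpos : 0 < (((Q : ℝ) ^ 2 : ℝ) * (4 * Real.pi * w) : ℂ).re := by
    have : (((Q : ℝ) ^ 2 : ℝ) * (4 * Real.pi * w) : ℂ) = ((4 * Real.pi * Q ^ 2 : ℝ) : ℂ) * w := by
      push_cast; ring
    rw [this, re_ofReal_mul]
    positivity
  have h := tsum_exp_neg_quadratic hpos (-(4 * Real.pi * w * r * Q) - I / 2)
  have hroot : (((Q : ℝ) ^ 2 : ℝ) * (4 * Real.pi * w) : ℂ) ^ (1 / 2 : ℂ)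
      = Q * (4 * Real.pi * w) ^ (1 / 2 : ℂ) := by
    have hQpos : 0 < (Q : ℝ) := by exact_mod_cast hQ.bot_lt
    rw [ofReal_mul_cpow (pow_pos hQpos 2) (by simp [hpi, hw0]), ofReal_cpow_half (sq_nonneg _),
      Real.sqrt_sq hQpos.le, ofReal_natCast]
  rw [hroot] at h
  have e1 : ∀ m : ℤ, exp (I * Real.pi * m) * exp (-(4 * Real.pi ^ 2 * w * (m * Q + r) ^ 2))
      = exp (-(4 * Real.pi ^ 2 * w * r ^ 2)) * exp (-Real.pi * (((Q : ℝ) ^ 2 : ℝ) * (4 * Real.pi * w)) * m ^ 2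
        + 2 * Real.pi * (-(4 * Real.pi * w * r * Q) - I / 2) * m) := fun m => by
    -- The term `-I/2` encodes the sign as `exp(-πim)`, which differs from `exp(πim)` by the period
    -- `2πim`.
    rw [← exp_add, ← exp_add, exp_eq_exp_iff_exists_int]
    refine ⟨m, ?_⟩
    push_cast
    ring
  have e2 : ∀ j : ℤ, exp (-(4 * Real.pi ^ 2 * w * r ^ 2)) *
      exp (-Real.pi / (((Q : ℝ) ^ 2 : ℝ) * (4 * Real.pi * w)) * (j + I * (-(4 * Real.pi * w * r * Q) - I / 2)) ^ 2)
      = exp (I * Real.pi * r * (2 * j + 1) / Q)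
        * exp (-((2 * (j : ℂ) + 1) ^ 2 / (16 * (Q : ℂ) ^ 2 * w))) := fun j => by
    rw [← exp_add, ← exp_add]
    congr 1
    have : (j + I * (-(4 * Real.pi * w * r * Q) - I / 2)) = (2 * (j : ℂ) + 1) / 2 - 4 * Real.pi * w * r * Q * I := by
      linear_combination (-1 / 2 : ℂ) * I_sq
    rw [this]
    push_cast
    field_simp
    ring_nf
    simp only [I_sq]
    ring
  simp_rw [e1]
  rw [tsum_mul_left, h, mul_left_comm, ← tsum_mul_left]
  simp_rw [e2]

/-- The cross term is a multiple of `2πi`, and `m²PQ` has the parity of `m` because `PQ` is odd. -/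
theorem exp_odd_residue {P : ℤ} {Q : ℕ} (hP : Odd P) (hQ : Odd Q) (m r : ℤ) :
    exp (-(I * Real.pi * P * (m * Q + r) ^ 2 / Q)) =
      exp (-(I * Real.pi * P * r ^ 2 / Q)) * exp (I * Real.pi * m) := by
  have hQ0 : (Q : ℂ) ≠ 0 := by exact_mod_cast hQ.pos.ne'
  rw [← exp_add, exp_eq_exp_iff_exists_int]
  obtain ⟨a, ha⟩ := hP.mul ((Int.odd_coe_nat Q).mpr hQ)
  obtain ⟨l, hl⟩ := Int.even_mul_succ_self m
  have ha' : (P : ℂ) * Q = 2 * a + 1 := by exact_mod_cast ha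
  have hl' : (m : ℂ) * (m + 1) = l + l := by exact_mod_cast hl
  refine ⟨-(P * m * r) - m ^ 2 * a - l, ?_⟩
  push_cast
  field_simp
  linear_combination (-(m : ℂ) ^ 2 * Q) * ha' - (Q : ℂ) * hl'

theorem summable_chi_exp (P : ℤ) (Q : ℕ) {w : ℂ} (hw : 0 < w.re) :
    Summable fun k : ℤ => exp (-(I * Real.pi * P * k ^ 2 / Q)) *
      exp (-(4 * Real.pi ^ 2 * w * (k : ℂ) ^ 2)) := by
  have hpos : 0 < (4 * Real.pi ^ 2 * w : ℂ).re := by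
    have : (4 * Real.pi ^ 2 * w : ℂ) = ((4 * Real.pi ^ 2 : ℝ) : ℂ) * w := by push_cast; ring
    rw [this, re_ofReal_mul]
    positivity
  refine (summable_exp_neg_mul_int_sq hpos).norm.of_norm_bounded fun k => ?_
  rw [norm_mul]
  have : -(I * Real.pi * P * k ^ 2 / Q) = ((-(Real.pi * P * k ^ 2 / Q) : ℝ) : ℂ) * I := by
    push_cast; ring
  rw [this, norm_exp_ofReal_mul_I, one_mul]

theorem tsum_chi_exp {P : ℤ} {Q : ℕ} (hP : Odd P) (hQ : Odd Q) {w : ℂ} (hw : 0 < w.re) :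
    ∑' k : ℤ, exp (-(I * Real.pi * P * k ^ 2 / Q)) * exp (-(4 * Real.pi ^ 2 * w * (k : ℂ) ^ 2))
      = 1 / (Q * (4 * Real.pi * w) ^ (1 / 2 : ℂ)) * ∑' j : ℤ, oddGauss P Q (2 * j + 1)
        * exp (-((2 * (j : ℂ) + 1) ^ 2 / (16 * (Q : ℂ) ^ 2 * w))) := by
  have : NeZero Q := ⟨hQ.pos.ne'⟩
  have hs := summable_chi_exp P Q hw
  let e := (Equiv.prodComm (Fin Q) ℤ).trans (Int.divModEquiv Q).symm
  rw [← Equiv.tsum_eq e]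
  have hs' := (Equiv.summable_iff e).mpr hs
  simp only [Function.comp_def] at hs'
  rw [Summable.tsum_prod hs', tsum_fintype]
  have e1 : ∀ (r : Fin Q) (m : ℤ), ((e (r, m) : ℤ) : ℂ) = m * Q + ((r : ℕ) : ℤ) := fun r m => by
    simp [e, Int.divModEquiv]
  simp only [e1, exp_odd_residue hP hQ, mul_assoc (exp (-(I * Real.pi * P * _ ^ 2 / Q)))]
  simp only [tsum_mul_left, tsum_exp_residue hw hQ.pos.ne']
  simp only [mul_left_comm _ (1 / (Q * (4 * Real.pi * w) ^ (1 / 2 : ℂ)))]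
  rw [← Finset.mul_sum]
  congr 1
  simp only [← tsum_mul_left]
  rw [← Summable.tsum_finsetSum]
  · refine tsum_congr fun j => ?_
    rw [oddGauss, Finset.sum_mul, ← Fin.sum_univ_eq_sum_range (fun r : ℕ => oddGaussTerm P Q (2 * j + 1) r * _)]
    refine Finset.sum_congr rfl fun r _ => ?_
    rw [← mul_assoc, ← exp_add, oddGaussTerm]
    congr 2
    push_cast
    ring
  · intro r _
    refine (summable_exp_neg_odd_sq_div hw hQ.pos.ne').norm.of_norm_bounded fun j => ?_
    rw [norm_mul, norm_mul]
    have h1 : -(I * Real.pi * P * (((r : ℕ) : ℤ) : ℂ) ^ 2 / Q) =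
        ((-(Real.pi * P * (r : ℕ) ^ 2 / Q) : ℝ) : ℂ) * I := by
      push_cast; ring
    have h2 : I * Real.pi * (((r : ℕ) : ℤ) : ℂ) * (2 * j + 1) / Q =
        ((Real.pi * (r : ℕ) * (2 * j + 1) / Q : ℝ) : ℂ) * I := by
      push_cast; ring
    rw [h1, h2, norm_exp_ofReal_mul_I, norm_exp_ofReal_mul_I, one_mul, one_mul]

theorem tsum_int_odd_sq {f : ℂ → ℂ} (hf : Summable fun j : ℤ => f ((2 * (j : ℂ) + 1) ^ 2)) :
    ∑' j : ℤ, f ((2 * (j : ℂ) + 1) ^ 2) = 2 * ∑' j : ℕ, f ((2 * (j : ℂ) + 1) ^ 2) := by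
  have e : ∀ j : ℕ, (2 * ((-((j : ℤ) + 1) : ℤ) : ℂ) + 1) ^ 2 = (2 * (j : ℂ) + 1) ^ 2 := fun j => by
    push_cast; ring
  set g : ℤ → ℂ := fun j => f ((2 * (j : ℂ) + 1) ^ 2) with hg
  have e1 : ∀ j : ℕ, g j = f ((2 * (j : ℂ) + 1) ^ 2) := fun j => by rw [hg]; simp only [Int.cast_natCast]
  have e2 : ∀ j : ℕ, g (-(j + 1)) = f ((2 * (j : ℂ) + 1) ^ 2) := fun j => by rw [hg]; simp only [e]
  have h1 : Summable fun j : ℕ => g j := hf.comp_injective (i := fun n : ℕ => (n : ℤ)) Nat.cast_injective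
  have h2 : Summable fun j : ℕ => g (-(j + 1)) := by
    simp only [e2, ← e1]; exact h1
  rw [tsum_of_nat_of_neg_add_one h1 h2]
  simp only [e2, e1]
  rw [two_mul]

theorem tsum_chi_exp_eq {P c d : ℤ} {Q : ℕ} (hP : Odd P) (hQ : Odd Q) (hcd : P * c + Q * d = 1)
    {w : ℂ} (hw : 0 < w.re) :
    ∑' k : ℤ, exp (-(I * Real.pi * P * k ^ 2 / Q)) * exp (-(4 * Real.pi ^ 2 * w * (k : ℂ) ^ 2))
      = 2 * (oddGauss P Q 1 * exp (-(I * Real.pi * c / (4 * Q)))) /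
          (Q * (4 * Real.pi * w) ^ (1 / 2 : ℂ)) *
        ∑' j : ℕ, exp (I * Real.pi * c * (2 * j + 1) ^ 2 / (4 * Q))
        * exp (-((2 * (j : ℂ) + 1) ^ 2 / (16 * (Q : ℂ) ^ 2 * w))) := by
  have hs : Summable fun j : ℤ => exp (I * Real.pi * c * (2 * j + 1) ^ 2 / (4 * Q))
        * exp (-((2 * (j : ℂ) + 1) ^ 2 / (16 * (Q : ℂ) ^ 2 * w))) := by
    refine (summable_exp_neg_odd_sq_div hw hQ.pos.ne').norm.of_norm_bounded fun j => ?_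
    rw [norm_mul]
    have h1 : I * Real.pi * c * (2 * j + 1) ^ 2 / (4 * Q) =
        ((Real.pi * c * (2 * j + 1) ^ 2 / (4 * Q) : ℝ) : ℂ) * I := by
      push_cast; ring
    rw [h1, norm_exp_ofReal_mul_I, one_mul]
  have h2 := tsum_int_odd_sq (f := fun x => exp (I * Real.pi * c * x / (4 * Q))
    * exp (-(x / (16 * (Q : ℂ) ^ 2 * w)))) hs
  rw [tsum_chi_exp hP hQ hw]
  have e : ∀ j : ℤ, oddGauss P Q (2 * j + 1) = oddGauss P Q 1 * exp (-(I * Real.pi * c / (4 * Q))) *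
      exp (I * Real.pi * c * (2 * j + 1) ^ 2 / (4 * Q)) := fun j => by
    rw [oddGauss_eq hP hQ ⟨j, rfl⟩ hcd]
    push_cast
    rfl
  simp only [e, mul_assoc (oddGauss P Q 1 * exp (-(I * Real.pi * c / (4 * Q))))]
  rw [tsum_mul_left]
  rw [h2]
  ring

/-! ### Integration by parts for heat-type series -/

/-- The principal branch of the square root. -/
noncomputable def csqrt (w : ℂ) : ℂ := w ^ (1 / 2 : ℂ)

theorem csqrt_sq (w : ℂ) : csqrt w ^ 2 = w := by
  rw [csqrt, ← cpow_nat_mul]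
  norm_num

theorem norm_csqrt (w : ℂ) : ‖csqrt w‖ = Real.sqrt ‖w‖ := by
  rw [← Real.sqrt_sq (norm_nonneg (csqrt w)), ← norm_pow, csqrt_sq]

theorem mem_slitPlane_of_re_nonneg {w : ℂ} (hw : 0 ≤ w.re) (h0 : w ≠ 0) : w ∈ slitPlane := by
  rw [mem_slitPlane_iff]
  by_contra! h
  exact h0 (Complex.ext (le_antisymm h.1 hw) h.2)

theorem hasDerivAt_csqrt {w : ℂ} (hw : w ∈ slitPlane) :
    HasDerivAt csqrt (1 / (2 * csqrt w)) w := by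
  have h := (hasDerivAt_id w).cpow_const (c := (1 / 2 : ℂ)) hw
  have hw0 := slitPlane_ne_zero hw
  have e : (1 / 2 : ℂ) * id w ^ ((1 / 2 : ℂ) - 1) * 1 = 1 / (2 * csqrt w) := by
    have h1 : csqrt w ≠ 0 := by
      intro h; apply hw0; rw [← csqrt_sq w, h]; simp
    rw [id, cpow_sub _ _ hw0, cpow_one, ← csqrt]
    nth_rewrite 2 [← csqrt_sq w]
    field_simp
  rw [e] at h
  exact h

/-- `exp (-A n² / w)` for `n = 2 j + 1`. -/
noncomputable def heatExp (A : ℝ) (j : ℕ) (w : ℂ) : ℂ := exp (-(A * (2 * (j : ℂ) + 1) ^ 2 / w))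

theorem norm_heatExp_le {A : ℝ} (hA : 0 ≤ A) (j : ℕ) {w : ℂ} (hw : 0 ≤ w.re) :
    ‖heatExp A j w‖ ≤ 1 := by
  have e : (A * (2 * (j : ℂ) + 1) ^ 2 / w) = ((A * (2 * (j : ℝ) + 1) ^ 2 : ℝ) : ℂ) * w⁻¹ := by
    push_cast; ring
  rw [heatExp, norm_exp, e, Real.exp_le_one_iff, neg_re, re_ofReal_mul, inv_re]
  have := normSq_nonneg w
  have : 0 ≤ A * (2 * (j : ℝ) + 1) ^ 2 * (w.re / normSq w) := by positivity
  linarith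

theorem hasDerivAt_heatExp (A : ℝ) (j : ℕ) {w : ℂ} (hw : w ≠ 0) :
    HasDerivAt (heatExp A j) (A * (2 * (j : ℂ) + 1) ^ 2 / w ^ 2 * heatExp A j w) w := by
  have h := ((hasDerivAt_inv hw).const_mul (-(A * (2 * (j : ℂ) + 1) ^ 2))).cexp
  have e : (fun y : ℂ => exp (-(A * (2 * (j : ℂ) + 1) ^ 2) * y⁻¹)) = heatExp A j := by
    ext y
    rw [heatExp, neg_mul, div_eq_mul_inv]
  rw [e] at h
  refine h.congr_deriv ?_
  rw [heatExp, neg_mul, ← div_eq_mul_inv]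
  ring

/-- First term of the integration by parts. -/
noncomputable def ibpMain (A : ℝ) (u : ℕ → ℂ) (j : ℕ) (w : ℂ) : ℂ :=
  u j * (w * csqrt w / (A * (2 * (j : ℂ) + 1) ^ 2)) * heatExp A j w

/-- Second term of the integration by parts. -/
noncomputable def ibpNext (A : ℝ) (u : ℕ → ℂ) (j : ℕ) (w : ℂ) : ℂ :=
  u j * (3 / 2 * (w ^ 2 * csqrt w / (A ^ 2 * (2 * (j : ℂ) + 1) ^ 4))) * heatExp A j w

/-- The remaining integrand after integrating by parts twice. -/
noncomputable def ibpRem (A : ℝ) (u : ℕ → ℂ) (j : ℕ) (w : ℂ) : ℂ :=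
  u j * (15 / 4 * (w * csqrt w / (A ^ 2 * (2 * (j : ℂ) + 1) ^ 4))) * heatExp A j w

theorem norm_two_mul_add_one (j : ℕ) : ‖(2 * (j : ℂ) + 1)‖ = 2 * j + 1 := by
  have : (2 * (j : ℂ) + 1) = ((2 * (j : ℝ) + 1 : ℝ) : ℂ) := by push_cast; ring
  rw [this, norm_real, Real.norm_of_nonneg (by positivity)]

theorem two_mul_add_one_ne_zero (j : ℕ) : (2 * (j : ℂ) + 1) ≠ 0 := by
  exact_mod_cast (Nat.succ_ne_zero (2 * j))

section

variable {A : ℝ} {u : ℕ → ℂ}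

theorem norm_mul_heatExp_le (hA : 0 ≤ A) (hu : ∀ j, ‖u j‖ ≤ 1) (j : ℕ) {w : ℂ} (hw : 0 ≤ w.re)
    (z : ℂ) : ‖u j * z * heatExp A j w‖ ≤ ‖z‖ := by
  rw [norm_mul, norm_mul]
  calc ‖u j‖ * ‖z‖ * ‖heatExp A j w‖ ≤ 1 * ‖z‖ * 1 := by
        gcongr
        · exact hu j
        · exact norm_heatExp_le hA j hw
    _ = ‖z‖ := by ring

theorem one_div_pow_four_le (j : ℕ) : 1 / (2 * (j : ℝ) + 1) ^ 4 ≤ 1 / (2 * (j : ℝ) + 1) ^ 2 := by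
  have h : (1 : ℝ) ≤ 2 * j + 1 := by have : (0 : ℝ) ≤ j := j.cast_nonneg
                                     linarith
  exact one_div_le_one_div_of_le (by positivity) (pow_le_pow_right₀ h (by norm_num))

theorem norm_ibpMain_le (hA : 0 < A) (hu : ∀ j, ‖u j‖ ≤ 1) (j : ℕ) {w : ℂ} (hw : 0 ≤ w.re) :
    ‖ibpMain A u j w‖ ≤ ‖w‖ * Real.sqrt ‖w‖ / A * (1 / (2 * (j : ℝ) + 1) ^ 2) := by
  refine (norm_mul_heatExp_le hA.le hu j hw _).trans (le_of_eq ?_)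
  rw [norm_div, norm_mul, norm_mul, norm_pow, norm_two_mul_add_one, norm_csqrt, norm_real,
    Real.norm_of_nonneg hA.le]
  field_simp

theorem norm_ibpNext_le (hA : 0 < A) (hu : ∀ j, ‖u j‖ ≤ 1) (j : ℕ) {w : ℂ} (hw : 0 ≤ w.re) :
    ‖ibpNext A u j w‖ ≤ 3 / 2 * (‖w‖ ^ 2 * Real.sqrt ‖w‖) / A ^ 2 * (1 / (2 * (j : ℝ) + 1) ^ 2) := by
  refine (norm_mul_heatExp_le hA.le hu j hw _).trans ?_
  have e : ‖(3 / 2 : ℂ)‖ = 3 / 2 := by norm_num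
  rw [norm_mul, e, norm_div, norm_mul, norm_mul, norm_pow, norm_pow, norm_pow, norm_two_mul_add_one,
    norm_csqrt, norm_real, Real.norm_of_nonneg hA.le]
  calc _ = 3 / 2 * (‖w‖ ^ 2 * Real.sqrt ‖w‖) / A ^ 2 * (1 / (2 * (j : ℝ) + 1) ^ 4) := by field_simp
    _ ≤ _ := by gcongr ?_ * ?_; exact one_div_pow_four_le j

theorem norm_ibpRem_le (hA : 0 < A) (hu : ∀ j, ‖u j‖ ≤ 1) (j : ℕ) {w : ℂ} (hw : 0 ≤ w.re) :
    ‖ibpRem A u j w‖ ≤ 15 / 4 * (‖w‖ * Real.sqrt ‖w‖) / A ^ 2 * (1 / (2 * (j : ℝ) + 1) ^ 2) := by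
  refine (norm_mul_heatExp_le hA.le hu j hw _).trans ?_
  have e : ‖(15 / 4 : ℂ)‖ = 15 / 4 := by norm_num
  rw [norm_mul, e, norm_div, norm_mul, norm_mul, norm_pow, norm_pow, norm_two_mul_add_one,
    norm_csqrt, norm_real, Real.norm_of_nonneg hA.le]
  calc _ = 15 / 4 * (‖w‖ * Real.sqrt ‖w‖) / A ^ 2 * (1 / (2 * (j : ℝ) + 1) ^ 4) := by field_simp
    _ ≤ _ := by gcongr ?_ * ?_; exact one_div_pow_four_le j

theorem summable_one_div_odd_sq : Summable fun j : ℕ => 1 / (2 * (j : ℝ) + 1) ^ 2 := by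
  have h := (Real.summable_one_div_nat_pow (p := 2)).mpr (by norm_num)
  have h2 := h.comp_injective (i := fun j : ℕ => 2 * j + 1) (fun a b h => by simpa using h)
  refine h2.congr fun j => ?_
  simp

/-- Two integrations by parts in differentiated form: the `w^(1/2)` term produced by `ibpMain`
cancels against the one from `ibpNext`, leaving only `ibpRem`, of order `w^(3/2)`. -/
theorem hasDerivAt_ibp (hA : 0 < A) (j : ℕ) {w : ℂ} (hw : w ∈ slitPlane) :
    HasDerivAt (fun w => ibpMain A u j w - ibpNext A u j w)
      (u j / csqrt w * heatExp A j w - ibpRem A u j w) w := by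
  have hw0 := slitPlane_ne_zero hw
  have hs0 : csqrt w ≠ 0 := by
    intro h; apply hw0; rw [← csqrt_sq w, h]; simp
  have hA0 : (A : ℂ) ≠ 0 := by exact_mod_cast hA.ne'
  have hn := two_mul_add_one_ne_zero j
  have hs := hasDerivAt_csqrt hw
  have hE := hasDerivAt_heatExp A j hw0
  have h1 := (((((hasDerivAt_id w).mul hs).div_const (A * (2 * (j : ℂ) + 1) ^ 2)).const_mul (u j)).mul hE)
  have h2 := ((((((hasDerivAt_id w).pow 2).mul hs).div_const
    (A ^ 2 * (2 * (j : ℂ) + 1) ^ 4)).const_mul (3 / 2 : ℂ)).const_mul (u j)).mul hE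
  refine (h1.sub h2).congr_deriv ?_
  simp only [ibpRem, Pi.mul_apply, id, Pi.pow_apply]
  have hsq := csqrt_sq w
  generalize csqrt w = s at *
  generalize heatExp A j w = E at *
  subst hsq
  field_simp
  ring

/-- The exponential has an essential singularity at `0`, but is bounded by `1` on the closed
half-plane, so the powers of `w` in front force the limit `0`. -/
theorem continuousOn_ibp (hA : 0 < A) (hu : ∀ j, ‖u j‖ ≤ 1) (j : ℕ) :
    ContinuousOn (fun w => ibpMain A u j w - ibpNext A u j w) {w | 0 ≤ w.re} := by
  intro w hw
  by_cases h0 : w = 0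
  · subst h0
    have hz : ibpMain A u j 0 - ibpNext A u j 0 = 0 := by simp [ibpMain, ibpNext]
    rw [ContinuousWithinAt, hz]
    refine squeeze_zero_norm' (a := fun w : ℂ => ‖w‖ * Real.sqrt ‖w‖ / A * (1 / (2 * (j : ℝ) + 1) ^ 2)
      + 3 / 2 * (‖w‖ ^ 2 * Real.sqrt ‖w‖) / A ^ 2 * (1 / (2 * (j : ℝ) + 1) ^ 2)) ?_ ?_
    · filter_upwards [self_mem_nhdsWithin] with w hw
      exact (norm_sub_le _ _).trans (add_le_add (norm_ibpMain_le hA hu j hw) (norm_ibpNext_le hA hu j hw))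
    · refine Tendsto.mono_left ?_ nhdsWithin_le_nhds
      have hc : Continuous fun w : ℂ => ‖w‖ * Real.sqrt ‖w‖ / A * (1 / (2 * (j : ℝ) + 1) ^ 2)
        + 3 / 2 * (‖w‖ ^ 2 * Real.sqrt ‖w‖) / A ^ 2 * (1 / (2 * (j : ℝ) + 1) ^ 2) := by fun_prop
      simpa using hc.tendsto 0
  · exact (hasDerivAt_ibp hA j (mem_slitPlane_of_re_nonneg hw h0)).continuousAt.continuousWithinAt

/-- The constant in `norm_sub_tsum_ibpMain_le`. -/
noncomputable def ibpConst : ℝ := 20 * ∑' j : ℕ, 1 / (2 * (j : ℝ) + 1) ^ 2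

theorem norm_ibp_le (hA : 0 < A) (hu : ∀ j, ‖u j‖ ≤ 1) {M : ℝ} (j : ℕ) {w : ℂ}
    (hw : 0 ≤ w.re) (hM : ‖w‖ ≤ M) :
    ‖ibpMain A u j w - ibpNext A u j w‖ ≤
      (M * Real.sqrt M / A + 3 / 2 * (M ^ 2 * Real.sqrt M) / A ^ 2) * (1 / (2 * (j : ℝ) + 1) ^ 2) := by
  have hM0 := (norm_nonneg w).trans hM
  rw [add_mul]
  refine (norm_sub_le _ _).trans (add_le_add ((norm_ibpMain_le hA hu j hw).trans ?_)
    ((norm_ibpNext_le hA hu j hw).trans ?_)) <;> gcongr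

/-- After subtracting both primitives from `D`, the derivative is `∑ ibpRem`, of size
`|w|^(3/2)/A²`. The mean value inequality on a convex half-disc, extended to its closure by
continuity, bounds the difference between `0` and `w`, even when `w` is imaginary. The `ibpNext` sum
already has the order of the error. -/
theorem norm_sub_tsum_ibpMain_le (hA : 0 < A) (hu : ∀ j, ‖u j‖ ≤ 1) {D : ℂ → ℂ}
    (hD : ContinuousOn D {w | 0 ≤ w.re}) (hD0 : D 0 = 0)
    (hD' : ∀ w : ℂ, 0 < w.re → HasDerivAt D (∑' j, u j / csqrt w * heatExp A j w) w) {w : ℂ}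
    (hw : 0 ≤ w.re) :
    ‖D w - ∑' j, ibpMain A u j w‖ ≤ ibpConst * (‖w‖ ^ 2 * Real.sqrt ‖w‖ / A ^ 2) := by
  rcases eq_or_ne w 0 with rfl | hw0
  · simp [ibpMain, hD0]
  set B : ℝ := ∑' j : ℕ, 1 / (2 * (j : ℝ) + 1) ^ 2 with hB
  have hB0 : 0 ≤ B := tsum_nonneg fun j => by positivity
  have hsB := summable_one_div_odd_sq
  -- The factor `2` puts `w` strictly inside the ball, so that both `w` and `0` lie in the closure
  -- of `S`.
  set M : ℝ := 2 * ‖w‖ with hM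
  have hwpos : 0 < ‖w‖ := norm_pos_iff.mpr hw0
  set S : Set ℂ := Metric.ball 0 M ∩ {w | 0 < w.re} with hS
  have hSo : IsOpen S := Metric.isOpen_ball.inter (isOpen_lt continuous_const continuous_re)
  have hSc : closure S ⊆ {w | ‖w‖ ≤ M ∧ 0 ≤ w.re} := by
    refine closure_minimal ?_ ((isClosed_le continuous_norm continuous_const).inter
      (isClosed_le continuous_const continuous_re))
    rintro z ⟨h1, h2⟩
    exact ⟨(mem_ball_zero_iff.mp h1).le, le_of_lt h2⟩
  have hmem : ∀ z : ℂ, ‖z‖ < M → 0 ≤ z.re → z ∈ closure S := by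
    intro z h1 h2
    refine Metric.isOpen_ball.inter_closure ⟨mem_ball_zero_iff.mpr h1, ?_⟩
    rw [closure_setOfPred_lt_re]
    exact h2
  have hconv : Convex ℝ S := (convex_ball _ _).inter (convex_halfSpace_re_gt 0)
  set g : ℕ → ℂ → ℂ := fun j w => ibpMain A u j w - ibpNext A u j w with hg
  set T : ℂ → ℂ := fun w => D w - ∑' j, g j w with hT
  set K : ℝ := M * Real.sqrt M / A + 3 / 2 * (M ^ 2 * Real.sqrt M) / A ^ 2 with hK
  have hsK := hsB.mul_left K
  have hTc : ContinuousOn T (closure S) := by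
    refine (hD.mono fun z hz => (hSc hz).2).sub (continuousOn_tsum (fun j =>
      (continuousOn_ibp hA hu j).mono fun z hz => (hSc hz).2) hsK fun j z hz => ?_)
    exact norm_ibp_le hA hu j (hSc hz).2 (hSc hz).1
  have hsl : ∀ z ∈ S, z ∈ slitPlane := fun z hz => Or.inl hz.2
  have hdiff : ∀ j, DifferentiableOn ℂ (g j) S := fun j z hz =>
    (hasDerivAt_ibp hA j (hsl z hz)).differentiableAt.differentiableWithinAt
  have hbound : ∀ j, ∀ z ∈ S, ‖g j z‖ ≤ K * (1 / (2 * (j : ℝ) + 1) ^ 2) := fun j z hz =>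
    norm_ibp_le hA hu j (hSc (subset_closure hz)).2 (hSc (subset_closure hz)).1
  have hsR : ∀ z : ℂ, 0 ≤ z.re → Summable fun j => ibpRem A u j z := fun z hz =>
    Summable.of_norm_bounded (hsB.mul_left _) fun j => norm_ibpRem_le hA hu j hz
  have hTd : ∀ z ∈ S, HasDerivAt T (∑' j, ibpRem A u j z) z := by
    intro z hz
    have h1 := hasSum_deriv_of_summable_norm hsK hdiff hSo hbound hz
    have h2 := ((differentiableOn_tsum_of_summable_norm hsK hdiff hSo hbound).differentiableAt
      (hSo.mem_nhds hz)).hasDerivAt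
    have h3 : (fun j => deriv (g j) z) = fun j => u j / csqrt z * heatExp A j z - ibpRem A u j z := by
      ext j
      exact (hasDerivAt_ibp hA j (hsl z hz)).deriv
    rw [h3] at h1
    have h4 := h1.add (hsR z (le_of_lt hz.2)).hasSum
    simp only [sub_add_cancel] at h4
    refine ((hD' z hz.2).sub h2).congr_deriv ?_
    rw [h4.tsum_eq]
    ring
  set L : ℝ := 15 / 4 * (M * Real.sqrt M) / A ^ 2 * B with hL
  have hL0 : 0 ≤ L := by positivity
  have hTb : ∀ z ∈ S, ‖∑' j, ibpRem A u j z‖ ≤ L := by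
    intro z hz
    have hz' := hSc (subset_closure hz)
    rw [hL, hB, ← tsum_mul_left]
    refine tsum_of_norm_bounded (hsB.mul_left _).hasSum fun j => ?_
    refine (norm_ibpRem_le hA hu j hz'.2).trans ?_
    have := hz'.1
    gcongr
  have hlip : LipschitzOnWith L.toNNReal T (closure S) := by
    refine LipschitzOnWith.closure hTc (LipschitzOnWith.of_dist_le_mul fun x hx y hy => ?_)
    rw [dist_eq_norm, dist_eq_norm, Real.coe_toNNReal _ hL0]
    exact hconv.norm_image_sub_le_of_norm_hasDerivWithin_le
      (fun z hz => (hTd z hz).hasDerivWithinAt) hTb hy hx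
  have hT0 : T 0 = 0 := by simp [hT, hg, ibpMain, ibpNext, hD0]
  have hTw : ‖T w‖ ≤ L * ‖w‖ := by
    have := hlip.dist_le_mul w (hmem w (by linarith) hw) 0 (hmem 0 (by simpa [hM] using hw0) (by simp))
    rwa [dist_eq_norm, dist_eq_norm, Real.coe_toNNReal _ hL0, hT0, sub_zero, sub_zero] at this
  have hsM : Summable fun j => ibpMain A u j w :=
    Summable.of_norm_bounded (hsB.mul_left _) fun j => norm_ibpMain_le hA hu j hw
  have hsN : Summable fun j => ibpNext A u j w :=
    Summable.of_norm_bounded (hsB.mul_left _) fun j => norm_ibpNext_le hA hu j hw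
  have hN : ‖∑' j, ibpNext A u j w‖ ≤ 3 / 2 * (‖w‖ ^ 2 * Real.sqrt ‖w‖) / A ^ 2 * B := by
    rw [hB, ← tsum_mul_left]
    exact tsum_of_norm_bounded (hsB.mul_left _).hasSum fun j => norm_ibpNext_le hA hu j hw
  have e : D w - ∑' j, ibpMain A u j w = T w - ∑' j, ibpNext A u j w := by
    simp only [hT, hg]
    rw [hsM.tsum_sub hsN]
    ring
  have hsqrt : Real.sqrt M ≤ 2 * Real.sqrt ‖w‖ := by
    rw [hM, Real.sqrt_mul (by norm_num)]
    gcongr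
    rw [Real.sqrt_le_left (by norm_num)]
    norm_num
  rw [e]
  calc ‖T w - ∑' j, ibpNext A u j w‖
      ≤ L * ‖w‖ + 3 / 2 * (‖w‖ ^ 2 * Real.sqrt ‖w‖) / A ^ 2 * B :=
        (norm_sub_le _ _).trans (add_le_add hTw hN)
    _ ≤ 15 / 4 * (2 * ‖w‖ * (2 * Real.sqrt ‖w‖)) / A ^ 2 * B * ‖w‖
        + 3 / 2 * (‖w‖ ^ 2 * Real.sqrt ‖w‖) / A ^ 2 * B := by
        rw [hL, hM] at *
        gcongr
    _ = 33 / 2 * (B * (‖w‖ ^ 2 * Real.sqrt ‖w‖ / A ^ 2)) := by ring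
    -- The sum `15 + 3/2` of the two contributions is rounded up.
    _ ≤ 20 * (B * (‖w‖ ^ 2 * Real.sqrt ‖w‖ / A ^ 2)) := by
        gcongr
        norm_num
    _ = ibpConst * (‖w‖ ^ 2 * Real.sqrt ‖w‖ / A ^ 2) := by rw [ibpConst]; ring

end

/-! ### Riemann's function at odd/odd rationals -/

/-- The `k`-th term of the increment of `phi`, in the variable `w = i h`
(equal to `0` for `k = 0`). -/
noncomputable def incTerm (P : ℤ) (Q : ℕ) (k : ℤ) (w : ℂ) : ℂ :=
  exp (-(I * Real.pi * P * k ^ 2 / Q)) *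
    ((exp (-(4 * Real.pi ^ 2 * w * k ^ 2)) - 1) / (-(4 * Real.pi ^ 2 * k ^ 2)))

/-- The increment of `phi` at `P / Q`, in the variable `w = i h`. -/
noncomputable def increment (P : ℤ) (Q : ℕ) (w : ℂ) : ℂ := w + ∑' k : ℤ, incTerm P Q k w

theorem norm_chi (P : ℤ) (Q : ℕ) (k : ℤ) : ‖exp (-(I * Real.pi * P * k ^ 2 / Q))‖ = 1 := by
  have : -(I * Real.pi * P * k ^ 2 / Q) = ((-(Real.pi * P * k ^ 2 / Q) : ℝ) : ℂ) * I := by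
    push_cast; ring
  rw [this, norm_exp_ofReal_mul_I]

theorem norm_incTerm_le (P : ℤ) (Q : ℕ) (k : ℤ) {w : ℂ} (hw : 0 ≤ w.re) :
    ‖incTerm P Q k w‖ ≤ 1 / (k : ℝ) ^ 2 := by
  have h1 : ‖exp (-(4 * Real.pi ^ 2 * w * k ^ 2))‖ ≤ 1 := by
    have : -(4 * Real.pi ^ 2 * w * k ^ 2) = ((-(4 * Real.pi ^ 2 * k ^ 2) : ℝ) : ℂ) * w := by
      push_cast; ring
    rw [norm_exp, Real.exp_le_one_iff, this, re_ofReal_mul]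
    have : 0 ≤ (4 * Real.pi ^ 2 * (k : ℝ) ^ 2) * w.re := by positivity
    linarith
  have h2 : ‖exp (-(4 * Real.pi ^ 2 * w * k ^ 2)) - 1‖ ≤ 2 := by
    refine (norm_sub_le _ _).trans ?_
    rw [norm_one]; linarith
  have h3 : ‖(-(4 * Real.pi ^ 2 * (k : ℂ) ^ 2))‖ = 4 * Real.pi ^ 2 * (k : ℝ) ^ 2 := by
    have : (-(4 * Real.pi ^ 2 * (k : ℂ) ^ 2)) = ((-(4 * Real.pi ^ 2 * (k : ℝ) ^ 2) : ℝ) : ℂ) := by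
      push_cast; ring
    rw [this, norm_real, norm_neg, Real.norm_of_nonneg (by positivity)]
  rw [incTerm, norm_mul, norm_chi, one_mul, norm_div, h3]
  calc _ ≤ 2 / (4 * Real.pi ^ 2 * (k : ℝ) ^ 2) := by gcongr
    _ = (1 / (2 * Real.pi ^ 2)) * (1 / (k : ℝ) ^ 2) := by
        rcases eq_or_ne (k : ℝ) 0 with h | h
        · simp [h]
        · field_simp; norm_num
    _ ≤ 1 * (1 / (k : ℝ) ^ 2) := by
        gcongr
        rw [div_le_one (by positivity)]
        nlinarith [Real.pi_gt_three]
    _ = _ := one_mul _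

theorem summable_incTerm (P : ℤ) (Q : ℕ) {w : ℂ} (hw : 0 ≤ w.re) :
    Summable fun k => incTerm P Q k w :=
  Summable.of_norm_bounded (Real.summable_one_div_int_pow.mpr one_lt_two) fun k =>
    norm_incTerm_le P Q k hw

/-- For `P = 0`, `Q = 1` the character is trivial. Division by zero makes `incTerm` vanish at `k =
0`, so the limit term `it` is added separately. -/
theorem hasSum_phiTerm (t : ℝ) : HasSum (phiTerm t) (I * t + ∑' k : ℤ, incTerm 0 1 k (I * t)) := by
  have h := (hasSum_ite_eq (0 : ℤ) (I * t : ℂ)).add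
    (summable_incTerm 0 1 (w := I * t) (by simp)).hasSum
  refine h.congr_fun fun k => ?_
  by_cases hk : k = 0
  · simp [hk, phiTerm, incTerm]
  · simp only [phiTerm, incTerm, hk, if_false, zero_add]
    simp only [Int.cast_zero, mul_zero, zero_mul, zero_div, neg_zero, exp_zero, one_mul, neg_mul]
    congr 4
    ring

theorem phi_add_sub_phi {P : ℤ} {Q : ℕ} {t : ℝ} (ht : (t : ℂ) = P / (4 * Real.pi * Q)) (h : ℝ) :
    phi (t + h) - phi t = increment P Q (I * h) := by
  have hpi : (Real.pi : ℂ) ≠ 0 := by exact_mod_cast Real.pi_ne_zero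
  rw [phi, phi, (hasSum_phiTerm _).tsum_eq, (hasSum_phiTerm _).tsum_eq, increment]
  have e : ∀ k : ℤ, incTerm P Q k (I * h) = incTerm 0 1 k (I * (t + h : ℝ)) - incTerm 0 1 k (I * t) := by
    intro k
    have e1 : exp (-(I * Real.pi * P * k ^ 2 / Q)) = exp (-(4 * Real.pi ^ 2 * (I * t) * k ^ 2)) := by
      rw [ht]
      congr 1
      field_simp
    have e2 : -(4 * Real.pi ^ 2 * (I * (t + h : ℝ)) * (k : ℂ) ^ 2) =
      -(4 * Real.pi ^ 2 * (I * t) * k ^ 2) + -(4 * Real.pi ^ 2 * (I * h) * k ^ 2) := by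
      push_cast; ring
    simp only [incTerm, e1, e2, exp_add]
    simp only [Int.cast_zero, mul_zero, zero_mul, zero_div, neg_zero, exp_zero, one_mul]
    ring
  simp only [e]
  rw [(summable_incTerm 0 1 (by simp)).tsum_sub (summable_incTerm 0 1 (by simp))]
  push_cast
  ring

/-- The term `k = 0` is identically zero, whereas the theta series has a `1` there; the summand `w`
of `increment` makes up the difference. -/
theorem hasDerivAt_incTerm (P : ℤ) (Q : ℕ) (k : ℤ) (w : ℂ) :
    HasDerivAt (incTerm P Q k) (exp (-(I * Real.pi * P * k ^ 2 / Q)) *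
      exp (-(4 * Real.pi ^ 2 * w * (k : ℂ) ^ 2)) - if k = 0 then 1 else 0) w := by
  have h := (((((hasDerivAt_id w).const_mul (4 * Real.pi ^ 2 : ℂ)).mul_const
    ((k : ℂ) ^ 2)).neg.cexp.sub_const 1).div_const (-(4 * Real.pi ^ 2 * (k : ℂ) ^ 2))).const_mul
      (exp (-(I * Real.pi * P * k ^ 2 / Q)))
  refine h.congr_deriv ?_
  by_cases hk : k = 0
  · simp [hk]
  · have hk' : (k : ℂ) ≠ 0 := by exact_mod_cast hk
    have hpi : (Real.pi : ℂ) ≠ 0 := by exact_mod_cast Real.pi_ne_zero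
    simp only [hk, if_false, sub_zero, id, Pi.neg_apply]
    field_simp

theorem continuousOn_increment (P : ℤ) (Q : ℕ) :
    ContinuousOn (increment P Q) {w | 0 ≤ w.re} :=
  continuousOn_id.add (continuousOn_tsum
    (fun k _ _ => (hasDerivAt_incTerm P Q k _).continuousAt.continuousWithinAt)
    (Real.summable_one_div_int_pow.mpr one_lt_two) fun k _ hw => norm_incTerm_le P Q k hw)

theorem increment_zero (P : ℤ) (Q : ℕ) : increment P Q 0 = 0 := by
  simp [increment, incTerm]

theorem hasDerivAt_increment (P : ℤ) (Q : ℕ) {w : ℂ} (hw : 0 < w.re) :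
    HasDerivAt (increment P Q) (∑' k : ℤ, exp (-(I * Real.pi * P * k ^ 2 / Q)) *
      exp (-(4 * Real.pi ^ 2 * w * (k : ℂ) ^ 2))) w := by
  set U : Set ℂ := {w | 0 < w.re}
  have hU : IsOpen U := isOpen_lt continuous_const continuous_re
  have hs := Real.summable_one_div_int_pow.mpr one_lt_two
  have hd : ∀ k, DifferentiableOn ℂ (incTerm P Q k) U := fun k z _ =>
    (hasDerivAt_incTerm P Q k z).differentiableAt.differentiableWithinAt
  have hb : ∀ k, ∀ z ∈ U, ‖incTerm P Q k z‖ ≤ 1 / (k : ℝ) ^ 2 := fun k z hz =>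
    norm_incTerm_le P Q k (le_of_lt hz)
  have h1 := hasSum_deriv_of_summable_norm hs hd hU hb hw
  have h2 := ((differentiableOn_tsum_of_summable_norm hs hd hU hb).differentiableAt
    (hU.mem_nhds hw)).hasDerivAt
  simp only [(hasDerivAt_incTerm P Q _ w).deriv] at h1
  have h3 := h1.add (hasSum_ite_eq (0 : ℤ) (1 : ℂ))
  simp only [sub_add_cancel] at h3
  refine ((hasDerivAt_id w).add h2).congr_deriv ?_
  rw [h3.tsum_eq, add_comm]

/-- The multiplier of the theta-modular map with lower left coefficient `c`. -/
noncomputable def thetaMultiplier (P : ℤ) (Q : ℕ) (c : ℤ) : ℂ :=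
  oddGauss P Q 1 * exp (-(I * Real.pi * c / (4 * Q))) / (Real.sqrt Q : ℂ)

theorem ofReal_sqrt_sq {x : ℝ} (hx : 0 ≤ x) : (Real.sqrt x : ℂ) ^ 2 = x := by
  exact_mod_cast Real.sq_sqrt hx

/-- Passing from `n = 1` to `n = Q` by completing the square costs the phase `exp(πi cQ/4)`, whose
eighth power is `1`. -/
theorem thetaMultiplier_pow_eight {P c d : ℤ} {Q : ℕ} (hP : Odd P) (hQ : Odd Q)
    (hcd : P * c + Q * d = 1) : thetaMultiplier P Q c ^ 8 = 1 := by
  have hQ0 : (Q : ℂ) ≠ 0 := by exact_mod_cast hQ.pos.ne'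
  have h := oddGauss_pow_eight hP hQ ⟨c, d, by linarith⟩
  rw [oddGauss_eq hP hQ ((Int.odd_coe_nat Q).mpr hQ) hcd, mul_pow _ (exp _), ← exp_nat_mul] at h
  have e : exp ((8 : ℕ) * (I * Real.pi * c * ((Q : ℤ) : ℂ) ^ 2 / (4 * Q))) = 1 := by
    rw [exp_eq_one_iff]
    refine ⟨c * Q, ?_⟩
    push_cast
    field_simp
    ring
  rw [e, mul_one] at h
  have hs : (Real.sqrt Q : ℂ) ^ 8 = (Q : ℂ) ^ 4 := by
    have := ofReal_sqrt_sq (Nat.cast_nonneg (α := ℝ) Q)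
    rw [show (8 : ℕ) = 2 * 4 by norm_num, pow_mul, this, ofReal_natCast]
  rw [thetaMultiplier, div_pow, h, hs]
  exact div_self (pow_ne_zero _ hQ0)

theorem thetaMultiplier_eq (P : ℤ) (Q : ℕ) (c c' : ℤ) :
    thetaMultiplier P Q c' = thetaMultiplier P Q c * exp (I * Real.pi * (c - c') / (4 * Q)) := by
  rw [thetaMultiplier, thetaMultiplier, div_mul_eq_mul_div,
    mul_assoc (oddGauss P Q 1), ← exp_add]
  congr 3
  ring

/-! ### Branches of the square root and evaluation at `w = ih` -/

theorem I_cpow_half : I ^ (1 / 2 : ℂ) = (1 + I) / (Real.sqrt 2 : ℂ) := by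
  have h2 : (Real.sqrt 2 : ℂ) ≠ 0 := by
    exact_mod_cast (Real.sqrt_pos.mpr two_pos).ne'
  have h2' := ofReal_sqrt_sq (two_pos (α := ℝ)).le
  rw [cpow_def_of_ne_zero I_ne_zero, log_I]
  have : (Real.pi / 2 * I * (1 / 2) : ℂ) = ((Real.pi / 4 : ℝ) : ℂ) * I := by push_cast; ring
  rw [this, exp_mul_I, ← ofReal_cos, ← ofReal_sin, Real.cos_pi_div_four, Real.sin_pi_div_four]
  push_cast at h2' ⊢
  field_simp
  linear_combination (1 + I) * h2'

theorem neg_I_cpow_half : (-I) ^ (1 / 2 : ℂ) = (1 - I) / (Real.sqrt 2 : ℂ) := by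
  have h2 : (Real.sqrt 2 : ℂ) ≠ 0 := by
    exact_mod_cast (Real.sqrt_pos.mpr two_pos).ne'
  have h2' := ofReal_sqrt_sq (two_pos (α := ℝ)).le
  rw [cpow_def_of_ne_zero (neg_ne_zero.mpr I_ne_zero), log_neg_I]
  have : (-(Real.pi / 2) * I * (1 / 2) : ℂ) = ((-(Real.pi / 4) : ℝ) : ℂ) * I := by push_cast; ring
  rw [this, exp_mul_I, ← ofReal_cos, ← ofReal_sin, Real.cos_neg, Real.sin_neg,
    Real.cos_pi_div_four, Real.sin_pi_div_four]
  push_cast at h2' ⊢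
  field_simp
  linear_combination (1 - I) * h2'

theorem csqrt_I_mul (h : ℝ) : csqrt (I * h) = (1 + I) / (Real.sqrt 2 : ℂ) * sqrtB h := by
  rcases lt_trichotomy h 0 with h0 | rfl | h0
  · have e : I * (h : ℂ) = ((-h : ℝ) : ℂ) * -I := by push_cast; ring
    rw [csqrt, e, ofReal_mul_cpow (by linarith) (neg_ne_zero.mpr I_ne_zero),
      ofReal_cpow_half (by linarith), neg_I_cpow_half, sqrtB, if_neg (by linarith)]
    linear_combination ((Real.sqrt (-h)) / (Real.sqrt 2) : ℂ) * I_sq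
  · simp [csqrt, sqrtB]
  · rw [csqrt, mul_comm, ofReal_mul_cpow h0 I_ne_zero, ofReal_cpow_half h0.le, I_cpow_half, sqrtB,
      if_pos h0.le, mul_comm]

theorem csqrt_I_mul_pow_three (h : ℝ) :
    csqrt (I * h) ^ 3 = (-1 + I) / (Real.sqrt 2 : ℂ) * sqrtB h ^ 3 := by
  have h2 : (Real.sqrt 2 : ℂ) ≠ 0 := by
    exact_mod_cast (Real.sqrt_pos.mpr two_pos).ne'
  have h2' := ofReal_sqrt_sq (two_pos (α := ℝ)).le
  push_cast at h2'
  have e : (1 + I) ^ 3 = (-1 + I) * (Real.sqrt 2 : ℂ) ^ 2 := by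
    rw [h2']
    linear_combination (3 + I) * I_sq
  rw [csqrt_I_mul, mul_pow, div_pow, e]
  field_simp

theorem rpow_nat_add_half {x : ℝ} (hx : 0 ≤ x) (n : ℕ) {y : ℝ} (hy : y = n + 1 / 2) :
    x ^ y = x ^ n * Real.sqrt x := by
  rw [hy, Real.rpow_add_of_nonneg hx n.cast_nonneg (by norm_num), Real.rpow_natCast,
    Real.sqrt_eq_rpow]

/-- The coefficients of the transformed theta series. -/
noncomputable def thetaCoeff (P : ℤ) (Q : ℕ) (c : ℤ) (j : ℕ) : ℂ :=
  thetaMultiplier P Q c * exp (I * Real.pi * c * (2 * j + 1) ^ 2 / (4 * Q))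

theorem norm_thetaCoeff_le {P c d : ℤ} {Q : ℕ} (hP : Odd P) (hQ : Odd Q)
    (hcd : P * c + Q * d = 1) (j : ℕ) : ‖thetaCoeff P Q c j‖ ≤ 1 := by
  have h1 : I * Real.pi * c * (2 * j + 1) ^ 2 / (4 * Q) =
      ((Real.pi * c * (2 * j + 1) ^ 2 / (4 * Q) : ℝ) : ℂ) * I := by
    push_cast; ring
  rw [thetaCoeff, norm_mul, h1, norm_exp_ofReal_mul_I, mul_one]
  have h := congrArg norm (thetaMultiplier_pow_eight hP hQ hcd)
  rw [norm_pow, norm_one] at h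
  exact ((pow_eq_one_iff_of_nonneg (norm_nonneg _) (by norm_num)).mp h).le

/-- The factor `√(πQ)` normalises the theta coefficients to modulus `1`, so the general estimate
applies with a constant free of `P, Q, c`. -/
theorem norm_increment_sub_le {P c d : ℤ} {Q : ℕ} (hP : Odd P) (hQ : Odd Q)
    (hcd : P * c + Q * d = 1) {w : ℂ} (hw : 0 ≤ w.re) :
    ‖(Real.sqrt (Real.pi * Q) : ℂ) * increment P Q w -
      ∑' j, ibpMain (1 / (16 * Q ^ 2)) (thetaCoeff P Q c) j w‖ ≤
      ibpConst * (‖w‖ ^ 2 * Real.sqrt ‖w‖ / (1 / (16 * Q ^ 2)) ^ 2) := by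
  have hQpos : 0 < (Q : ℝ) := by exact_mod_cast hQ.pos
  have hQ0 : (Q : ℂ) ≠ 0 := by exact_mod_cast hQ.pos.ne'
  refine norm_sub_tsum_ibpMain_le (D := fun w => (Real.sqrt (Real.pi * Q) : ℂ) * increment P Q w)
    (by positivity) (norm_thetaCoeff_le hP hQ hcd)
    (continuousOn_const.mul (continuousOn_increment P Q)) (by simp [increment_zero]) ?_ hw
  intro w hw
  refine ((hasDerivAt_increment P Q hw).const_mul _).congr_deriv ?_
  rw [tsum_chi_exp_eq hP hQ hcd hw, ← mul_assoc, ← tsum_mul_left]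
  refine tsum_congr fun j => ?_
  have hw0 : w ≠ 0 := fun h => by simp [h] at hw
  have hs0 : csqrt w ≠ 0 := by
    intro h; apply hw0; rw [← csqrt_sq w, h]; simp
  have e4 : (4 * Real.pi * w : ℂ) ^ (1 / 2 : ℂ) = 2 * Real.sqrt Real.pi * csqrt w := by
    have : (4 * Real.pi * w : ℂ) = ((4 * Real.pi : ℝ) : ℂ) * w := by push_cast; ring
    rw [this, ofReal_mul_cpow (by positivity) hw0, ofReal_cpow_half (by positivity),
      Real.sqrt_mul (by norm_num), show (4 : ℝ) = 2 ^ 2 by norm_num, Real.sqrt_sq (by norm_num), csqrt]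
    push_cast
    ring
  have eh : exp (-((2 * (j : ℂ) + 1) ^ 2 / (16 * (Q : ℂ) ^ 2 * w))) = heatExp (1 / (16 * Q ^ 2)) j w := by
    rw [heatExp]
    congr 1
    push_cast
    field_simp
  have hsq := ofReal_sqrt_sq hQpos.le
  rw [ofReal_natCast] at hsq
  have hsq0 : (Real.sqrt Q : ℂ) ≠ 0 := by exact_mod_cast (Real.sqrt_pos.mpr hQpos).ne'
  have hsp0 : (Real.sqrt Real.pi : ℂ) ≠ 0 := by
    exact_mod_cast (Real.sqrt_pos.mpr Real.pi_pos).ne'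
  rw [e4, eh, thetaCoeff, thetaMultiplier, Real.sqrt_mul Real.pi_pos.le]
  push_cast
  rw [show (Q : ℂ) * (2 * Real.sqrt Real.pi * csqrt w) =
    (Real.sqrt Q : ℂ) ^ 2 * (2 * Real.sqrt Real.pi * csqrt w) by rw [hsq]]
  generalize exp (-(I * Real.pi * c / (4 * Q))) = X
  generalize exp (I * Real.pi * c * (2 * j + 1) ^ 2 / (4 * Q)) = Y
  field_simp

/-- The identity behind it is `1/b(h) = 1/(Q²h) + 4πc/Q`: its two parts give the exponential
`exp(-n²/(16Q²w))` at `w = ih` and the phase `exp(πi c n²/(4Q))`. -/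
theorem tsum_ibpMain_eq {P c : ℤ} {Q : ℕ} (hQ : Odd Q) {h : ℝ}
    (hne : 1 + 4 * Real.pi * c * Q * h ≠ 0) :
    ∑' j, ibpMain (1 / (16 * Q ^ 2)) (thetaCoeff P Q c) j (I * h) =
      (Real.sqrt (Real.pi * Q) : ℂ) * (thetaMultiplier P Q c *
        (-16 * ((1 - I) / (Real.sqrt (2 * Real.pi) : ℂ)) *
          Z1 ((Q : ℝ) ^ 2 * h / (1 + 4 * Real.pi * c * Q * h)) *
          (((Q : ℝ) ^ (3 / 2 : ℝ) : ℝ) : ℂ) * sqrtB h ^ 3)) := by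
  rcases eq_or_ne h 0 with rfl | h0
  · simp [ibpMain, sqrtB]
  have hQpos : 0 < (Q : ℝ) := by exact_mod_cast hQ.pos
  have hQ0 : (Q : ℂ) ≠ 0 := by exact_mod_cast hQ.pos.ne'
  have hh0 : (h : ℂ) ≠ 0 := by exact_mod_cast h0
  have hne' : (1 + 4 * Real.pi * c * Q * h : ℂ) ≠ 0 := by exact_mod_cast hne
  have hI := I_ne_zero
  have e : ∀ j : ℕ, ibpMain (1 / (16 * Q ^ 2)) (thetaCoeff P Q c) j (I * h) =
      thetaMultiplier P Q c * (16 * Q ^ 2) * csqrt (I * h) ^ 3 *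
      (exp (I * (2 * (j : ℂ) + 1) ^ 2 /
        (16 * ((((Q : ℝ) ^ 2 * h / (1 + 4 * Real.pi * c * Q * h) : ℝ)) : ℂ))) /
          (2 * (j : ℂ) + 1) ^ 2) := by
    intro j
    have hn := two_mul_add_one_ne_zero j
    have e1 : exp (I * (2 * (j : ℂ) + 1) ^ 2 /
        (16 * ((((Q : ℝ) ^ 2 * h / (1 + 4 * Real.pi * c * Q * h) : ℝ)) : ℂ))) =
        exp (I * Real.pi * c * (2 * j + 1) ^ 2 / (4 * Q)) * heatExp (1 / (16 * Q ^ 2)) j (I * h) := by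
      rw [heatExp, ← exp_add]
      congr 1
      push_cast
      field_simp
      linear_combination (4 : ℂ) * I_sq
    have e2 : csqrt (I * h) ^ 3 = I * h * csqrt (I * h) := by
      rw [pow_succ, csqrt_sq]
    rw [e1, ibpMain, thetaCoeff, e2]
    push_cast
    field_simp
  simp only [e]
  rw [tsum_mul_left, ← Z1, csqrt_I_mul_pow_three, rpow_nat_add_half hQpos.le 1 (by norm_num),
    Real.sqrt_mul Real.pi_pos.le, Real.sqrt_mul zero_le_two]
  have hsq := ofReal_sqrt_sq hQpos.le
  rw [ofReal_natCast] at hsq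
  have hs2 : (Real.sqrt 2 : ℂ) ≠ 0 := by exact_mod_cast (Real.sqrt_pos.mpr two_pos).ne'
  have hsp0 : (Real.sqrt Real.pi : ℂ) ≠ 0 := by
    exact_mod_cast (Real.sqrt_pos.mpr Real.pi_pos).ne'
  push_cast
  field_simp
  rw [hsq]
  ring

theorem norm_phi_add_sub_phi_sub_le {P c d : ℤ} {Q : ℕ} (hP : Odd P) (hQ : Odd Q)
    (hcd : P * c + Q * d = 1) {t : ℝ} (ht : (t : ℂ) = P / (4 * Real.pi * Q)) {h : ℝ}
    (hne : 1 + 4 * Real.pi * c * Q * h ≠ 0) :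
    ‖phi (t + h) - phi t - thetaMultiplier P Q c *
        (-16 * ((1 - I) / (Real.sqrt (2 * Real.pi) : ℂ)) *
          Z1 ((Q : ℝ) ^ 2 * h / (1 + 4 * Real.pi * c * Q * h)) *
          (((Q : ℝ) ^ (3 / 2 : ℝ) : ℝ) : ℂ) * sqrtB h ^ 3)‖ ≤
      256 * ibpConst * ((Q : ℝ) ^ (7 / 2 : ℝ) * |h| ^ (5 / 2 : ℝ)) := by
  have hQpos : 0 < (Q : ℝ) := by exact_mod_cast hQ.pos
  have hC : 0 ≤ ibpConst := mul_nonneg (by norm_num) (tsum_nonneg fun j => by positivity)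
  have h1 := norm_increment_sub_le hP hQ hcd (w := I * h) (by simp)
  rw [tsum_ibpMain_eq hQ hne, ← mul_sub, norm_mul, norm_real,
    Real.norm_of_nonneg (Real.sqrt_nonneg _), ← phi_add_sub_phi ht, norm_mul, norm_I, one_mul,
    norm_real, Real.norm_eq_abs] at h1
  rw [rpow_nat_add_half (y := 7 / 2) hQpos.le 3 (by norm_num),
    rpow_nat_add_half (abs_nonneg h) 2 (by norm_num)]
  have hsQ : 0 < Real.sqrt Q := Real.sqrt_pos.mpr hQpos
  have hsq := Real.sq_sqrt hQpos.le
  have hle : Real.sqrt Q ≤ Real.sqrt (Real.pi * Q) := by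
    apply Real.sqrt_le_sqrt
    nlinarith [Real.pi_gt_three]
  -- Since `1/A² = 256 Q⁴`, dividing by `√(πQ) ≥ √Q` leaves `256 Q^(7/2)`.
  refine le_of_mul_le_mul_left ?_ hsQ
  refine (mul_le_mul_of_nonneg_right hle (norm_nonneg _)).trans (h1.trans (le_of_eq ?_))
  field_simp
  rw [hsq]
  ring

/-! ### Arithmetic of the reduced fraction, admissible coefficients and rescaling -/

theorem pTilde_qTilde {p : ℤ} {q : ℕ} (hpq : IsCoprime p (q : ℤ)) (hq : q ≡ 2 [MOD 4]) :
    pTilde p q = p ∧ 2 * qTilde p q = q ∧ Odd p ∧ Odd (qTilde p q) := by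
  obtain ⟨m, hm⟩ : ∃ m : ℕ, q = 2 * (2 * m + 1) := by
    have : q % 4 = 2 := hq
    exact ⟨q / 4, by omega⟩
  have hco : IsCoprime p ((2 * m + 1 : ℕ) : ℤ) := by
    rw [hm] at hpq
    push_cast at hpq ⊢
    exact hpq.of_mul_right_right
  have hodd : Odd p := by
    rw [hm] at hpq
    push_cast at hpq
    exact Int.isCoprime_two_right.mp hpq.of_mul_right_left
  have e : 2 * (p : ℚ) / (q : ℚ) = (p : ℚ) / ((2 * m + 1 : ℕ) : ℤ) := by
    rw [hm]
    push_cast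
    field_simp
  have hpos : (0 : ℤ) < ((2 * m + 1 : ℕ) : ℤ) := by positivity
  have hnat := Int.isCoprime_iff_nat_coprime.mp hco
  have h1 : pTilde p q = p := by
    rw [pTilde, e, Rat.num_div_eq_of_coprime hpos hnat]
  have h2 : qTilde p q = 2 * m + 1 := by
    have := Rat.den_div_eq_of_coprime hpos hnat
    rw [qTilde, e]
    exact_mod_cast this
  exact ⟨h1, by rw [h2, hm], hodd, by rw [h2]; exact ⟨m, rfl⟩⟩

/-- Under `a = c + Q`, `b = d - P` the determinant `ad - bc` equals `Pc + Qd`. -/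
theorem IsThetaCoeff.exists_mul_add_mul_eq_one {P Q c : ℤ} (h : IsThetaCoeff P Q c) :
    ∃ d : ℤ, P * c + Q * d = 1 := by
  obtain ⟨a, b, d, h1, -, h2, h3⟩ := h
  exact ⟨d, by subst h2 h3; linear_combination h1⟩

theorem sqrtB_div_sq {x : ℝ} (hx : 0 < x) (h : ℝ) : sqrtB (h / x ^ 2) = sqrtB h / x := by
  have hx2 : 0 < x ^ 2 := by positivity
  have e : ∀ y : ℝ, 0 ≤ y → Real.sqrt (y / x ^ 2) = Real.sqrt y / x := fun y hy => by
    rw [Real.sqrt_div hy, Real.sqrt_sq hx.le]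
  by_cases h0 : 0 ≤ h
  · rw [sqrtB, sqrtB, if_pos h0, if_pos (by positivity), e h h0]
    push_cast; rfl
  · have h1 : ¬ 0 ≤ h / x ^ 2 := not_le.mpr (div_neg_of_neg_of_pos (not_le.mp h0) hx2)
    rw [sqrtB, sqrtB, if_neg h0, if_neg h1, ← neg_div, e _ (by linarith)]
    push_cast; ring

theorem cpm_div_sq {x : ℝ} (hx : 0 < x) (cp cm : ℤ) (h : ℝ) :
    cpm cp cm (h / x ^ 2) = cpm cp cm h := by
  have hx2 : 0 < x ^ 2 := by positivity
  have : 0 ≤ h / x ^ 2 ↔ 0 ≤ h := by rw [le_div_iff₀ hx2, zero_mul]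
  simp only [cpm, this]

/-- The radius simplifies to `1/(4π|c|Q)`, so the pole of `b` lies outside the open interval. -/
theorem one_add_ne_zero_of_abs_lt {Q : ℕ} (hQ : 0 < Q) {c : ℤ} (hc : c ≠ 0) {h : ℝ}
    (hh : |h| < 1 / (4 * Real.pi * (|(c : ℝ)| / (Q : ℝ))) * (1 / (Q : ℝ) ^ 2)) :
    1 + 4 * Real.pi * c * Q * h ≠ 0 := by
  have hQ' : 0 < (Q : ℝ) := by exact_mod_cast hQ
  have hc' : 0 < |(c : ℝ)| := abs_pos.mpr (by exact_mod_cast hc)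
  have e : 1 / (4 * Real.pi * (|(c : ℝ)| / (Q : ℝ))) * (1 / (Q : ℝ) ^ 2) =
      1 / (4 * Real.pi * |(c : ℝ)| * Q) := by
    field_simp
  rw [e, lt_div_iff₀ (by positivity)] at hh
  have h1 : |4 * Real.pi * c * Q * h| < 1 := by
    rw [abs_mul, abs_mul, abs_mul, abs_of_pos (by positivity : (0 : ℝ) < 4 * Real.pi), Nat.abs_cast]
    linarith
  have := (abs_lt.mp h1).1
  linarith

end RiemannFunction

theorem mainTheorem6 :
    ∃ C : ℝ, 0 < C ∧
      ∀ (p : ℤ) (q : ℕ), IsCoprime p (q : ℤ) → q ≡ 2 [MOD 4] →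
        ∃ e : ℤ → ℂ,
          (∀ c : ℤ,
            RiemannFunction.IsThetaCoeff (RiemannFunction.pTilde p q)
              (RiemannFunction.qTilde p q) c → e c ^ 8 = 1) ∧
          (∀ c c' : ℤ,
            RiemannFunction.IsThetaCoeff (RiemannFunction.pTilde p q)
              (RiemannFunction.qTilde p q) c →
            RiemannFunction.IsThetaCoeff (RiemannFunction.pTilde p q)
              (RiemannFunction.qTilde p q) c' →
            e c' = e c * Complex.exp (Complex.I * (Real.pi : ℂ) * ((c : ℂ) - (c' : ℂ))
              / (4 * (RiemannFunction.qTilde p q : ℂ)))) ∧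
          ∀ cp cm : ℤ,
            RiemannFunction.IsThetaCoeff (RiemannFunction.pTilde p q)
              (RiemannFunction.qTilde p q) cp →
            RiemannFunction.IsThetaCoeff (RiemannFunction.pTilde p q)
              (RiemannFunction.qTilde p q) cm →
            (RiemannFunction.qTilde p q : ℤ) ≤ cp → cp ≤ 3 * (RiemannFunction.qTilde p q : ℤ) →
            -3 * (RiemannFunction.qTilde p q : ℤ) ≤ cm → cm ≤ -(RiemannFunction.qTilde p q : ℤ) →
            (∀ h : ℝ,
              |h| < 1 / (4 * Real.pi * (|(RiemannFunction.cpm cp cm h : ℝ)|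
                    / (RiemannFunction.qTilde p q : ℝ)))
                  * (1 / (RiemannFunction.qTilde p q : ℝ) ^ 2) →
              ‖RiemannFunction.phi (RiemannFunction.tpq p q + h)
                  - RiemannFunction.phi (RiemannFunction.tpq p q)
                  - e (RiemannFunction.cpm cp cm h)
                    * (-16 * ((1 - Complex.I) / (Real.sqrt (2 * Real.pi) : ℂ))
                      * RiemannFunction.Z1
                          (RiemannFunction.bFun (RiemannFunction.qTilde p q) cp cm h)
                      * (((RiemannFunction.qTilde p q : ℝ) ^ (3 / 2 : ℝ) : ℝ) : ℂ)
                      * RiemannFunction.sqrtB h ^ 3)‖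
                ≤ C * ((RiemannFunction.qTilde p q : ℝ) ^ (7 / 2 : ℝ) * |h| ^ (5 / 2 : ℝ))) ∧
            (∀ h : ℝ,
              |h| < 1 / (4 * Real.pi * (|(RiemannFunction.cpm cp cm h : ℝ)|
                    / (RiemannFunction.qTilde p q : ℝ))) →
              ‖RiemannFunction.phi
                    (RiemannFunction.tpq p q + h / (RiemannFunction.qTilde p q : ℝ) ^ 2)
                  - RiemannFunction.phi (RiemannFunction.tpq p q)
                  - e (RiemannFunction.cpm cp cm h)
                    / (((RiemannFunction.qTilde p q : ℝ) ^ (3 / 2 : ℝ) : ℝ) : ℂ)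
                    * (-16 * ((1 - Complex.I) / (Real.sqrt (2 * Real.pi) : ℂ))
                      * RiemannFunction.Z1
                          (RiemannFunction.bFun (RiemannFunction.qTilde p q) cp cm
                            (h / (RiemannFunction.qTilde p q : ℝ) ^ 2))
                      * RiemannFunction.sqrtB h ^ 3)‖
                ≤ C * (|h| ^ (5 / 2 : ℝ)
                    / (RiemannFunction.qTilde p q : ℝ) ^ (3 / 2 : ℝ))) := by

  have hB : 0 < RiemannFunction.ibpConst := mul_pos (by norm_num)
    (RiemannFunction.summable_one_div_odd_sq.tsum_pos (fun j => by positivity) 0 (by norm_num))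
  refine ⟨256 * RiemannFunction.ibpConst, by positivity, fun p q hpq hq => ?_⟩
  obtain ⟨hp, hqq, hpodd, hqodd⟩ := RiemannFunction.pTilde_qTilde hpq hq
  rw [hp]
  have ht : (RiemannFunction.tpq p q : ℂ) =
      p / (4 * Real.pi * RiemannFunction.qTilde p q) := by
    have hq' : (q : ℝ) = 2 * RiemannFunction.qTilde p q := by exact_mod_cast hqq.symm
    rw [RiemannFunction.tpq, hq']
    push_cast
    rw [div_div]
    congr 1
    ring
  generalize RiemannFunction.tpq p q = t at ht ⊢
  generalize RiemannFunction.qTilde p q = Q at hqq hqodd ht ⊢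
  have hQpos : 0 < (Q : ℝ) := by exact_mod_cast hqodd.pos
  have hQint : 0 < (Q : ℤ) := by exact_mod_cast hqodd.pos
  refine ⟨RiemannFunction.thetaMultiplier p Q, fun c hc => ?_, fun c c' _ _ =>
    RiemannFunction.thetaMultiplier_eq p Q c c', fun cp cm hcp hcm h1 _ _ h4 => ?_⟩
  · obtain ⟨d, hd⟩ := hc.exists_mul_add_mul_eq_one
    exact RiemannFunction.thetaMultiplier_pow_eight hpodd hqodd hd
  have hcpm : ∀ h : ℝ, RiemannFunction.IsThetaCoeff p Q (RiemannFunction.cpm cp cm h) ∧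
      RiemannFunction.cpm cp cm h ≠ 0 := by
    intro h
    unfold RiemannFunction.cpm
    split_ifs
    · exact ⟨hcp, by omega⟩
    · exact ⟨hcm, by omega⟩
  have key : ∀ h : ℝ, |h| < 1 / (4 * Real.pi * (|(RiemannFunction.cpm cp cm h : ℝ)| / (Q : ℝ)))
                  * (1 / (Q : ℝ) ^ 2) → _ := fun h hh =>
    RiemannFunction.norm_phi_add_sub_phi_sub_le hpodd hqodd
      (hcpm h).1.exists_mul_add_mul_eq_one.choose_spec ht
      (RiemannFunction.one_add_ne_zero_of_abs_lt hqodd.pos (hcpm h).2 hh)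
  refine ⟨key, fun h hh => ?_⟩
  have hcd := RiemannFunction.cpm_div_sq hQpos cp cm h
  have habs : |h / (Q : ℝ) ^ 2| = |h| / (Q : ℝ) ^ 2 := by
    rw [abs_div, abs_of_pos (by positivity : 0 < (Q : ℝ) ^ 2)]
  have hk := key (h / (Q : ℝ) ^ 2) (by
    rw [hcd, habs, div_eq_mul_one_div]
    gcongr)
  have hsQ : 0 < Real.sqrt Q := Real.sqrt_pos.mpr hQpos
  have hsq := Real.sq_sqrt hQpos.le
  have hsQc : (Real.sqrt Q : ℂ) ≠ 0 := by exact_mod_cast hsQ.ne'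
  have hQc : (Q : ℂ) ≠ 0 := by exact_mod_cast hQpos.ne'
  have hsqc := RiemannFunction.ofReal_sqrt_sq hQpos.le
  rw [Complex.ofReal_natCast] at hsqc
  have r3 := RiemannFunction.rpow_nat_add_half (y := 3 / 2) hQpos.le 1 (by norm_num)
  have r7 := RiemannFunction.rpow_nat_add_half (y := 7 / 2) hQpos.le 3 (by norm_num)
  have r5 := RiemannFunction.rpow_nat_add_half (y := 5 / 2) (abs_nonneg (h / (Q : ℝ) ^ 2)) 2
    (by norm_num)
  have r5' := RiemannFunction.rpow_nat_add_half (y := 5 / 2) (abs_nonneg h) 2 (by norm_num)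
  rw [RiemannFunction.bFun, hcd] at *
  rw [RiemannFunction.sqrtB_div_sq hQpos] at hk
  -- Replacing `h` by `h/Q²` turns `Q^(3/2)` into `Q^(3/2 - 3)` in the main term and `Q^(7/2)` into
  -- `Q^(7/2 - 5)` in the error; both equal `Q^(-3/2)`.
  convert hk using 1
  · congr 2
    rw [r3]
    push_cast
    field_simp
    rw [hsqc]
  · rw [r3, r7, r5, r5', habs, Real.sqrt_div (abs_nonneg h), Real.sqrt_sq hQpos.le]
    field_simp
    rw [hsq]
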